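/- Let $q$ be a real number with $0<|q|<1$, and let $\mathcal H=L_2(\mathbb N)\otimes L_2(\mathbb Z)$ with canonical orthonormal basis $(e_{ij})_{i\in\mathbb N,\,j\in\mathbb Z}$. Let $\alpha,\beta$ be the bounded operators $$\alpha e_{ij}=\sqrt{1-q^{2i}}\,e_{i-1,j}\quad(e_{-1,j}:=0),\qquad \beta e_{ij}=q^i e_{i,j-1}$$ (the standard representation of the generators of $C(SU_q(2))$), let $\mathcal A_f$ be the $*$-algebra generated by $\alpha$ and $\beta$, and let $D$ be the self-adjoint operator $De_{ij}=(i\,\mathrm{sgn}(j)+j)e_{ij}$, where $\mathrm{sgn}(j)=1$ for $j\ge 0$ and $\mathrm{sgn}(j)=-1$ for $j<0$. For $i\in\mathbb Z$ put $\alpha_i=\alpha^i$ if $i\ge0$ and $\alpha_i=(\alpha^*)^{-i}$ if $i<0$. Let $\Omega^\bullet(\mathcal A_f)=\bigoplus_n\Omega^n(\mathcal A_f)$, with differential $\delta$, be the universal graded differential algebra over $\mathcal A_f$, represented on $\mathcal H$ by $\pi(a_0\,\delta a_1\cdots\delta a_n)=a_0[D,a_1]\cdots[D,a_n]$. Define $$(\omega,\eta)_D=\mathop{\mathrm{Lim}}_{\varepsilon\to0+}\frac{\mathrm{Tr}\big(\pi(\omega)^*\pi(\eta)e^{-\varepsilon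 D^2}\big)}{\mathrm{Tr}\big(e^{-\varepsilon D^2}\big)},$$ where $\mathrm{Lim}$ is any positive linear functional on the functions bounded near $0$ in $(0,\infty)$ that extends the limit as $\varepsilon\to0+$. Let $\mathfrak K_n=\{\omega\in\Omega^n(\mathcal A_f):(\omega,\omega)_D=0\}$ for $n\ge 0$, $\mathfrak K_{-1}=0$, and let $$\widetilde\Omega^n_D(\mathcal A_f)=\Omega^n(\mathcal A_f)/(\mathfrak K_n+\delta\mathfrak K_{n-1}),$$ with the differential $d$ induced by $\delta$, be the complex of square-integrable forms. Then, for every choice of $\mathrm{Lim}$: (i) $\widetilde\Omega^n_D(\mathcal A_f)=0$ for all $n\ge2$. (ii) There is a unital algebra homomorphism $\sigma:\mathcal A_f\to\mathbb C[z,z^{-1}]$ with $\sigma(\alpha)=z$, $\sigma(\alpha^*)=z^{-1}$, $\sigma(\beta)=\sigma(\beta^*)=0$. For $n=0,1$ there is a linear isomorphism $\Phi_n:\widetilde\Omega^n_D(\mathcal A_f)\to\mathbb C[z,z^{-1}]$ of $\mathcal A_f$-bimodules, where $\mathcal A_f$ acts on both sides of $\mathbb C[z,z^{-1}]$ through $\sigma$;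 that is, $\Phi_n([a\omega b])=\sigma(a)\Phi_n([\omega])\sigma(b)$ for $a,b\in\mathcal A_f$, $\omega\in\Omega^n(\mathcal A_f)$. They can be chosen such that $\Phi_0([a])=\sigma(a)$ for $a\in\mathcal A_f$, and such that the differential $d:\mathcal A_f\to\widetilde\Omega^1_D(\mathcal A_f)$ is given, for all $i\in\mathbb Z$ and $j,k\in\mathbb N$, by $$\Phi_1\big(d(\alpha_i\beta^j\beta^{*k})\big)=\begin{cases}-i\,z^i,& j=k=0,\\ 0,&\text{otherwise.}\end{cases}$$ -/

import Mathlib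

open Filter Topology
open scoped ComplexOrder InnerProductSpace

noncomputable section

/-! ### The universal differential graded algebra of a unital complex algebra -/

namespace UDGA

variable (A : Type*) [Ring A] [Algebra ℂ A]

/-- Relations among the generators: the pair `(a, b)` stands for `a + δ b`. -/
inductive Rel : TensorAlgebra ℂ (A × A) → TensorAlgebra ℂ (A × A) → Prop
  | one : Rel (TensorAlgebra.ι ℂ ((1 : A), (0 : A))) 1
  | mul (a b : A) : Rel (TensorAlgebra.ι ℂ (a * b, (0 : A)))
      (TensorAlgebra.ι ℂ (a, (0 : A)) * TensorAlgebra.ι ℂ (b, (0 : A)))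
  | leibniz (a b : A) : Rel (TensorAlgebra.ι ℂ ((0 : A), a * b))
      (TensorAlgebra.ι ℂ (a, (0 : A)) * TensorAlgebra.ι ℂ ((0 : A), b) +
        TensorAlgebra.ι ℂ ((0 : A), a) * TensorAlgebra.ι ℂ (b, (0 : A)))

/-- The universal differential graded algebra `Ω^•(A)`: the unital complex algebra generated by
`A` and by symbols `δ a`, linear in `a ∈ A`, subject to `δ (a b) = a (δ b) + (δ a) b`. -/
def Omega : Type _ := RingQuot (Rel A)

instance : Ring (Omega A) := inferInstanceAs (Ring (RingQuot (Rel A)))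
instance : Algebra ℂ (Omega A) := inferInstanceAs (Algebra ℂ (RingQuot (Rel A)))

/-- The quotient map from the tensor algebra. -/
def mkHom : TensorAlgebra ℂ (A × A) →ₐ[ℂ] Omega A := RingQuot.mkAlgHom ℂ (Rel A)

theorem mkHom_rel {x y : TensorAlgebra ℂ (A × A)} (h : Rel A x y) : mkHom A x = mkHom A y :=
  RingQuot.mkAlgHom_rel ℂ h

/-- The inclusion `A → Ω^•(A)`. -/
def incl : A →ₐ[ℂ] Omega A :=
  AlgHom.ofLinearMap
    ((mkHom A).toLinearMap ∘ₗ TensorAlgebra.ι ℂ ∘ₗ LinearMap.inl ℂ A A)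
    (by
      have := mkHom_rel A (Rel.one (A := A))
      simpa using this)
    (by
      intro a b
      have := mkHom_rel A (Rel.mul a b)
      simpa using this)

/-- The symbols `δ a`, for `a ∈ A`. -/
def delta0 : A →ₗ[ℂ] Omega A :=
  (mkHom A).toLinearMap ∘ₗ TensorAlgebra.ι ℂ ∘ₗ LinearMap.inr ℂ A A

theorem delta0_mul (a b : A) :
    delta0 A (a * b) = incl A a * delta0 A b + delta0 A a * incl A b := by
  have := mkHom_rel A (Rel.leibniz a b)
  simpa [incl, delta0] using this

variable {A} in
/-- The universal property of `Ω^•(A)` as an algebra. -/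
def lift {B : Type*} [Ring B] [Algebra ℂ B] (f : A →ₐ[ℂ] B) (g : A →ₗ[ℂ] B)
    (h : ∀ a b, g (a * b) = f a * g b + g a * f b) : Omega A →ₐ[ℂ] B :=
  RingQuot.liftAlgHom ℂ
    ⟨TensorAlgebra.lift ℂ (LinearMap.coprod f.toLinearMap g), by
      intro x y r
      cases r with
      | one => simp
      | mul a b => simp
      | leibniz a b => simp [h]⟩

theorem lift_mkHom {B : Type*} [Ring B] [Algebra ℂ B] (f : A →ₐ[ℂ] B) (g : A →ₗ[ℂ] B)
    (h : ∀ a b, g (a * b) = f a * g b + g a * f b) (x : TensorAlgebra ℂ (A × A)) :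
    lift f g h (mkHom A x) = TensorAlgebra.lift ℂ (LinearMap.coprod f.toLinearMap g) x :=
  RingQuot.liftAlgHom_mkAlgHom_apply ℂ _ _ x

theorem lift_incl {B : Type*} [Ring B] [Algebra ℂ B] (f : A →ₐ[ℂ] B) (g : A →ₗ[ℂ] B)
    (h : ∀ a b, g (a * b) = f a * g b + g a * f b) (a : A) :
    lift f g h (incl A a) = f a := by
  have := lift_mkHom A f g h (TensorAlgebra.ι ℂ (a, 0))
  simpa [incl] using this

theorem lift_delta0 {B : Type*} [Ring B] [Algebra ℂ B] (f : A →ₐ[ℂ] B) (g : A →ₗ[ℂ] B)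
    (h : ∀ a b, g (a * b) = f a * g b + g a * f b) (a : A) :
    lift f g h (delta0 A a) = g a := by
  have := lift_mkHom A f g h (TensorAlgebra.ι ℂ (0, a))
  simpa [delta0] using this

/-- The algebra homomorphism `ω ↦ ((-1)^{deg ω} ω, δ ω; 0, ω)` into `2 × 2` matrices, given on
generators by `a ↦ (a, δ a; 0, a)` and `δ a ↦ (-δ a, 0; 0, δ a)`. Its multiplicativity is the
graded Leibniz rule `δ (ω η) = (δ ω) η + (-1)^{deg ω} ω (δ η)`. -/
def matHom : Omega A →ₐ[ℂ] Matrix (Fin 2) (Fin 2) (Omega A) :=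
  lift
    (AlgHom.ofLinearMap
      ({ toFun := fun a => !![incl A a, delta0 A a; 0, incl A a]
         map_add' := by intro a b; ext i j; fin_cases i <;> fin_cases j <;> simp
         map_smul' := by intro c a; ext i j; fin_cases i <;> fin_cases j <;> simp } :
        A →ₗ[ℂ] Matrix (Fin 2) (Fin 2) (Omega A))
      (by
        have h1 : delta0 A 1 = 0 := by
          have := delta0_mul A 1 1
          simpa using this
        ext i j; fin_cases i <;> fin_cases j <;> simp [h1])
      (by
        intro a b
        ext i j; fin_cases i <;> fin_cases j <;>
          simp [Matrix.mul_apply, Fin.sum_univ_two, delta0_mul]))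
    ({ toFun := fun a => !![-delta0 A a, 0; 0, delta0 A a]
       map_add' := by
        intro a b; ext i j; fin_cases i <;> fin_cases j <;> simp [add_comm]
       map_smul' := by intro c a; ext i j; fin_cases i <;> fin_cases j <;> simp } :
        A →ₗ[ℂ] Matrix (Fin 2) (Fin 2) (Omega A))
    (by
      intro a b
      ext i j; fin_cases i <;> fin_cases j <;>
        simp [delta0_mul, add_comm])

/-- The universal differential `δ : Ω^•(A) → Ω^•(A)`. -/
def delta : Omega A →ₗ[ℂ] Omega A :=
  { toFun := fun ω => matHom A ω 0 1
    map_add' := by intro x y; simp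
    map_smul' := by intro c x; simp }

/-- The space `Ω^n(A)` of `n`-forms: the linear span of the products
`a₀ (δ a₁) ⋯ (δ aₙ)` with `a₀, …, aₙ ∈ A`. -/
def forms (n : ℕ) : Submodule ℂ (Omega A) :=
  LinearMap.range (incl A).toLinearMap * LinearMap.range (delta0 A) ^ n

theorem matHom_incl (a : A) : matHom A (incl A a) = !![incl A a, delta0 A a; 0, incl A a] := by
  rw [matHom, lift_incl]; rfl

theorem matHom_delta0 (a : A) :
    matHom A (delta0 A a) = !![-delta0 A a, 0; 0, delta0 A a] := by
  rw [matHom, lift_delta0]; rfl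

theorem delta_incl (a : A) : delta A (incl A a) = delta0 A a := by
  simp [delta, matHom_incl]

theorem matHom_one_one (ω : Omega A) (n : ℕ) (h : ω ∈ LinearMap.range (delta0 A) ^ n) :
    matHom A ω 1 1 = ω ∧ matHom A ω 0 1 = 0 := by
  induction n generalizing ω with
  | zero =>
    rw [pow_zero, Submodule.mem_one] at h
    obtain ⟨c, rfl⟩ := h
    simp [AlgHom.commutes, Matrix.algebraMap_matrix_apply]
  | succ n ih =>
    rw [pow_succ'] at h
    refine Submodule.mul_induction_on h ?_ ?_
    · rintro _ ⟨a, rfl⟩ η hη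
      obtain ⟨h1, h2⟩ := ih η hη
      simp [Matrix.mul_apply, Fin.sum_univ_two, matHom_delta0, h1, h2]
    · intro x y hx hy
      simp [hx.1, hx.2, hy.1, hy.2]

theorem delta_pow (n : ℕ) (ω : Omega A) (h : ω ∈ LinearMap.range (delta0 A) ^ n) :
    delta A ω = 0 := (matHom_one_one A ω n h).2

/-- `δ (a η) = (δ a) η` whenever `η` is a sum of products `(δ a₁) ⋯ (δ aₙ)`. -/
theorem delta_incl_mul (n : ℕ) (a : A) (η : Omega A) (h : η ∈ LinearMap.range (delta0 A) ^ n) :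
    delta A (incl A a * η) = delta0 A a * η := by
  obtain ⟨h1, h2⟩ := matHom_one_one A η n h
  simp [delta, Matrix.mul_apply, Fin.sum_univ_two, matHom_incl, h1, h2]

theorem delta_mem_pow (n : ℕ) (ω : Omega A) (h : ω ∈ forms A n) :
    delta A ω ∈ LinearMap.range (delta0 A) ^ (n + 1) := by
  refine Submodule.mul_induction_on h ?_ ?_
  · rintro _ ⟨a, rfl⟩ η hη
    rw [AlgHom.toLinearMap_apply, delta_incl_mul A n a η hη, pow_succ']
    exact Submodule.mul_mem_mul ⟨a, rfl⟩ hη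
  · intro x y hx hy
    rw [map_add]
    exact add_mem hx hy

theorem pow_le_forms (n : ℕ) : LinearMap.range (delta0 A) ^ n ≤ forms A n := by
  intro η hη
  have := Submodule.mul_mem_mul (M := LinearMap.range (incl A).toLinearMap)
    (LinearMap.mem_range_self (incl A).toLinearMap 1) hη
  simpa [forms] using this

theorem delta_mem (n : ℕ) (ω : Omega A) (h : ω ∈ forms A n) : delta A ω ∈ forms A (n + 1) :=
  pow_le_forms A _ (delta_mem_pow A n ω h)

theorem delta_delta (n : ℕ) (ω : Omega A) (h : ω ∈ forms A n) : delta A (delta A ω) = 0 :=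
  delta_pow A _ _ (delta_mem_pow A n ω h)

theorem incl_mul_mem (n : ℕ) (a : A) (ω : Omega A) (h : ω ∈ forms A n) :
    incl A a * ω ∈ forms A n := by
  refine Submodule.mul_induction_on h ?_ ?_
  · rintro _ ⟨b, rfl⟩ η hη
    rw [AlgHom.toLinearMap_apply, ← mul_assoc, ← map_mul]
    exact Submodule.mul_mem_mul ⟨a * b, rfl⟩ hη
  · intro x y hx hy
    rw [mul_add]
    exact add_mem hx hy

theorem pow_mul_incl_mem (n : ℕ) (b : A) (η : Omega A)
    (h : η ∈ LinearMap.range (delta0 A) ^ n) : η * incl A b ∈ forms A n := by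
  induction n generalizing η b with
  | zero =>
    rw [pow_zero, Submodule.mem_one] at h
    obtain ⟨c, rfl⟩ := h
    rw [← Algebra.smul_def]
    refine Submodule.smul_mem _ _ ?_
    simp [forms]
  | succ n ih =>
    rw [pow_succ] at h
    refine Submodule.mul_induction_on h ?_ ?_
    · rintro ξ hξ _ ⟨a, rfl⟩
      have key : ξ * delta0 A a * incl A b =
          ξ * delta0 A (a * b) - (ξ * incl A a) * delta0 A b := by
        rw [delta0_mul]; noncomm_ring
      rw [key]
      refine sub_mem (pow_le_forms A _ ?_) ?_
      · rw [pow_succ]; exact Submodule.mul_mem_mul hξ ⟨_, rfl⟩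
      · have := Submodule.mul_mem_mul (ih a ξ hξ)
          (LinearMap.mem_range_self (delta0 A) b)
        rwa [forms, mul_assoc, ← pow_succ] at this
    · intro x y hx hy
      rw [add_mul]
      exact add_mem hx hy

theorem mul_incl_mem (n : ℕ) (b : A) (ω : Omega A) (h : ω ∈ forms A n) :
    ω * incl A b ∈ forms A n := by
  refine Submodule.mul_induction_on h ?_ ?_
  · rintro _ ⟨a, rfl⟩ η hη
    rw [AlgHom.toLinearMap_apply, mul_assoc]
    exact incl_mul_mem A n a _ (pow_mul_incl_mem A n b η hη)
  · intro x y hx hy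
    rw [add_mul]
    exact add_mem hx hy

theorem incl_mem (a : A) : incl A a ∈ forms A 0 := by simp [forms]

end UDGA

/-! ### Operators on `ℓ²(X)` -/

/-- The Hilbert space `ℓ²(X)`, with canonical orthonormal basis `e x = lp.single 2 x 1`. -/
abbrev L2 (X : Type*) : Type _ := lp (fun _ : X => ℂ) 2

/-- `v ∈ dom D` if and only if `D` and `v` satisfy `∑ₓ |d x|² |v x|² < ∞`; then
`(D v) x = d x * v x`. This is the self-adjoint operator `e x ↦ d x • e x`. -/
def diagOp {X : Type*} (d : X → ℝ) : L2 X →ₗ.[ℂ] L2 X where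
  domain :=
    { carrier := {v | Memℓp (fun x => (d x : ℂ) * v x) 2}
      zero_mem' := by
        have : (fun x => (d x : ℂ) * (0 : L2 X) x) = (0 : X → ℂ) := by ext; simp
        simp only [Set.mem_ofPred_eq]
        rw [this]
        exact zero_memℓp
      add_mem' := by
        intro v w hv hw
        have : (fun x => (d x : ℂ) * (v + w) x) =
            (fun x => (d x : ℂ) * v x) + (fun x => (d x : ℂ) * w x) := by
          ext; simp [mul_add]
        simp only [Set.mem_ofPred_eq] at *
        rw [this]
        exact hv.add hw
      smul_mem' := by
        intro c v hv
        have : (fun x => (d x : ℂ) * (c • v) x) = c • (fun x => (d x : ℂ) * v x) := by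
          ext; simp [mul_left_comm]
        simp only [Set.mem_ofPred_eq] at *
        rw [this]
        exact hv.const_smul c }
  toFun :=
    { toFun := fun v => ⟨fun x => (d x : ℂ) * (v : L2 X) x, v.2⟩
      map_add' := by intro v w; ext x; exact mul_add _ _ _
      map_smul' := by intro c v; ext x; simp [mul_left_comm] }

/-- The bounded operator `C` is (the closure of) the commutator `[D, T] = D T - T D`: the bounded
operator `T` preserves the domain of `D`, and `C v = D (T v) - T (D v)` on that domain. -/
def IsCommutator {H : Type*} [NormedAddCommGroup H] [InnerProductSpace ℂ H] (D : H →ₗ.[ℂ] H)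
    (T C : H →L[ℂ] H) : Prop :=
  ∀ v : D.domain, ∃ h : T v ∈ D.domain, C v = D ⟨T v, h⟩ - T (D v)

section Commutator

variable {X : Type*} {d : X → ℝ}

theorem diagOp_apply (v : (diagOp d).domain) (x : X) :
    (diagOp d v) x = (d x : ℂ) * (v : L2 X) x := rfl

theorem mem_diagOp (v : L2 X) :
    v ∈ (diagOp d).domain ↔ Memℓp (fun x => (d x : ℂ) * v x) 2 := Iff.rfl

theorem isCommutator_of {T C : L2 X →L[ℂ] L2 X}
    (h : ∀ (v : (diagOp d).domain) (x : X),
      (d x : ℂ) * (T v) x = (C v) x + (T (diagOp d v)) x) : IsCommutator (diagOp d) T C := by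
  intro v
  have hm : T v ∈ (diagOp d).domain := by
    rw [mem_diagOp]
    have : (fun x => (d x : ℂ) * (T v) x) = ⇑(C v + T (diagOp d v)) := by
      ext x; simp [h]
    rw [this]
    exact lp.memℓp _
  refine ⟨hm, ?_⟩
  ext x
  have := h v x
  simp only [lp.coeFn_sub, Pi.sub_apply, diagOp_apply]
  rw [this]; ring

theorem IsCommutator.coord {T C : L2 X →L[ℂ] L2 X} (h : IsCommutator (diagOp d) T C)
    (v : (diagOp d).domain) (x : X) :
    (d x : ℂ) * (T v) x = (C v) x + (T (diagOp d v)) x := by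
  obtain ⟨hm, e⟩ := h v
  rw [e]
  simp [diagOp_apply]

theorem isCommutator_algebraMap (c : ℂ) :
    IsCommutator (diagOp d) (algebraMap ℂ (L2 X →L[ℂ] L2 X) c) 0 := by
  refine isCommutator_of fun v x => ?_
  simp [Algebra.algebraMap_eq_smul_one, diagOp_apply, mul_left_comm]

theorem IsCommutator.add {T T' C C' : L2 X →L[ℂ] L2 X} (h : IsCommutator (diagOp d) T C)
    (h' : IsCommutator (diagOp d) T' C') : IsCommutator (diagOp d) (T + T') (C + C') := by
  refine isCommutator_of fun v x => ?_
  have e := h.coord v x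
  have e' := h'.coord v x
  simp only [add_apply, lp.coeFn_add, Pi.add_apply, mul_add, e, e']
  ring

theorem IsCommutator.smul {T C : L2 X →L[ℂ] L2 X} (h : IsCommutator (diagOp d) T C) (c : ℂ) :
    IsCommutator (diagOp d) (c • T) (c • C) := by
  refine isCommutator_of fun v x => ?_
  have e := h.coord v x
  simp only [smul_apply, lp.coeFn_smul, Pi.smul_apply, smul_eq_mul,
    mul_left_comm _ c, e]
  ring

theorem IsCommutator.mul {T T' C C' : L2 X →L[ℂ] L2 X} (h : IsCommutator (diagOp d) T C)
    (h' : IsCommutator (diagOp d) T' C') :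
    IsCommutator (diagOp d) (T * T') (T * C' + C * T') := by
  refine isCommutator_of fun v x => ?_
  obtain ⟨hm, e'⟩ := h' v
  have e := h.coord ⟨T' v, hm⟩ x
  have e2 : diagOp d ⟨T' v, hm⟩ = C' v + T' (diagOp d v) := by rw [e']; abel
  rw [e2] at e
  have hmul : ∀ (S S' : L2 X →L[ℂ] L2 X) (u : L2 X), (S * S') u = S (S' u) := fun _ _ _ => rfl
  simp only [add_apply, hmul, lp.coeFn_add, Pi.add_apply, map_add] at e ⊢
  rw [e]; ring

variable [DecidableEq X]

theorem single_mem (x : X) (c : ℂ) : lp.single 2 x c ∈ (diagOp d).domain := by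
  rw [mem_diagOp]
  have : (fun y => (d y : ℂ) * (lp.single (E := fun _ : X => ℂ) 2 x c) y) =
      ⇑(lp.single (E := fun _ : X => ℂ) 2 x ((d x : ℂ) * c)) := by
    ext y
    by_cases hy : y = x
    · subst hy; simp
    · simp [hy]
  rw [this]
  exact lp.memℓp _

theorem diagOp_single (x : X) (c : ℂ) :
    diagOp d ⟨lp.single 2 x c, single_mem x c⟩ = (d x : ℂ) • lp.single 2 x c := by
  ext y
  rw [diagOp_apply, lp.coeFn_smul, Pi.smul_apply, smul_eq_mul]
  by_cases hy : y = x
  · subst hy; simp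
  · simp [hy]

theorem L2.ext_single {S T : L2 X →L[ℂ] L2 X} (h : ∀ x c, S (lp.single 2 x c) = T (lp.single 2 x c)) :
    S = T := by
  ext1 v
  have hv := lp.hasSum_single (E := fun _ : X => ℂ) (p := 2) (by norm_num) v
  have h1 := hv.mapL S
  have h2 := hv.mapL T
  simp only [h] at h1
  exact h1.unique h2

theorem IsCommutator.unique {T C C' : L2 X →L[ℂ] L2 X} (h : IsCommutator (diagOp d) T C)
    (h' : IsCommutator (diagOp d) T C') : C = C' := by
  refine L2.ext_single fun x c => ?_
  obtain ⟨_, e⟩ := h ⟨_, single_mem x c⟩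
  obtain ⟨_, e'⟩ := h' ⟨_, single_mem x c⟩
  rw [e, e']

theorem L2.inner_single (x : X) (c : ℂ) (v : L2 X) :
    ⟪lp.single (E := fun _ : X => ℂ) 2 x c, v⟫_ℂ = (starRingEnd ℂ) c * v x := by
  rw [lp.inner_single_left]
  simp [mul_comm]

theorem IsCommutator.star {T C : L2 X →L[ℂ] L2 X} (h : IsCommutator (diagOp d) T C) :
    IsCommutator (diagOp d) (star T) (-star C) := by
  refine isCommutator_of fun v x => ?_
  have key : ∀ (S : L2 X →L[ℂ] L2 X) (w : L2 X),
      ((Star.star S) w) x = ⟪S (lp.single (E := fun _ : X => ℂ) 2 x 1), w⟫_ℂ := by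
    intro S w
    rw [ContinuousLinearMap.star_eq_adjoint, ← ContinuousLinearMap.adjoint_inner_right,
      L2.inner_single]
    simp
  obtain ⟨hm, e⟩ := h ⟨_, single_mem x 1⟩
  rw [diagOp_single] at e
  have sym : ∀ u : (diagOp d).domain, ⟪diagOp d u, (v : L2 X)⟫_ℂ = ⟪(u : L2 X), diagOp d v⟫_ℂ := by
    intro u
    rw [lp.inner_eq_tsum, lp.inner_eq_tsum]
    refine tsum_congr fun y => ?_
    rw [diagOp_apply, diagOp_apply]
    simp [mul_left_comm, mul_assoc]
  have e2 := sym ⟨_, hm⟩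
  have e3 : diagOp d ⟨_, hm⟩ = C (lp.single 2 x 1) + (d x : ℂ) • T (lp.single 2 x 1) := by
    rw [e, map_smul]; abel
  rw [e3, inner_add_left, inner_smul_left] at e2
  simp only [neg_apply, lp.coeFn_neg, Pi.neg_apply, key]
  rw [← e2]
  simp

end Commutator

/-! ### Weighted shifts -/

/-- The bounded operator `(W v) x = w x * v (φ x)` on `ℓ²(X)`, for an injective map `φ` and a
bounded weight `w`. -/
def weightedShift {X : Type*} (φ : X → X) (hφ : Function.Injective φ) (w : X → ℂ)
    (hw : ∃ C : ℝ, ∀ x, ‖w x‖ ≤ C) : L2 X →L[ℂ] L2 X :=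
  have hsum : ∀ v : L2 X, Summable (fun x => ‖v (φ x)‖ ^ 2) := fun v => by
    have := (memℓp_gen_iff (p := 2) (by norm_num)).1 (lp.memℓp v)
    have := this.comp_injective hφ
    simpa [Function.comp_def] using this
  have hbd : ∀ (C : ℝ), (∀ x, ‖w x‖ ≤ C) → ∀ (v : L2 X) x,
      ‖w x * v (φ x)‖ ^ 2 ≤ C ^ 2 * ‖v (φ x)‖ ^ 2 := fun C hC v x => by
    rw [norm_mul, mul_pow]
    gcongr
    exact hC x
  have hmem : ∀ v : L2 X, Memℓp (fun x => w x * v (φ x)) 2 := fun v => by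
    obtain ⟨C, hC⟩ := hw
    refine memℓp_gen ?_
    have := Summable.of_nonneg_of_le (fun x => by positivity) (hbd C hC v) ((hsum v).mul_left _)
    simpa using this
  LinearMap.mkContinuousOfExistsBound
    { toFun := fun v => ⟨fun x => w x * v (φ x), hmem v⟩
      map_add' := by intro u v; ext x; exact mul_add _ _ _
      map_smul' := by intro c v; ext x; simp [mul_left_comm] }
    (by
      obtain ⟨C, hC⟩ := hw
      refine ⟨|C|, fun v => ?_⟩
      refine lp.norm_le_of_forall_sum_le (p := 2) (by norm_num) (by positivity) fun s => ?_
      have h2 : ∑ x ∈ s, ‖v (φ x)‖ ^ 2 ≤ ‖v‖ ^ 2 := by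
        have h3 := lp.sum_rpow_le_norm_rpow (p := 2) (by norm_num) v (s.map ⟨φ, hφ⟩)
        simpa using h3
      have h4 : ∑ x ∈ s, ‖w x * v (φ x)‖ ^ 2 ≤ C ^ 2 * ‖v‖ ^ 2 := by
        calc ∑ x ∈ s, ‖w x * v (φ x)‖ ^ 2 ≤ ∑ x ∈ s, C ^ 2 * ‖v (φ x)‖ ^ 2 :=
              Finset.sum_le_sum fun x _ => hbd C hC v x
          _ = C ^ 2 * ∑ x ∈ s, ‖v (φ x)‖ ^ 2 := by rw [Finset.mul_sum]
          _ ≤ C ^ 2 * ‖v‖ ^ 2 := by gcongr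
      have h5 : (|C| * ‖v‖) ^ 2 = C ^ 2 * ‖v‖ ^ 2 := by rw [mul_pow, sq_abs]
      rw [← h5] at h4
      simpa using h4)

theorem weightedShift_apply {X : Type*} (φ : X → X) (hφ : Function.Injective φ) (w : X → ℂ)
    (hw : ∃ C : ℝ, ∀ x, ‖w x‖ ≤ C) (v : L2 X) (x : X) :
    (weightedShift φ hφ w hw v) x = w x * v (φ x) := rfl

theorem isCommutator_weightedShift {X : Type*} {d : X → ℝ} (φ : X → X)
    (hφ : Function.Injective φ) (w : X → ℂ) (hw : ∃ C : ℝ, ∀ x, ‖w x‖ ≤ C)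
    (hc : ∃ C : ℝ, ∀ x, ‖((d x : ℂ) - d (φ x)) * w x‖ ≤ C) :
    IsCommutator (diagOp d) (weightedShift φ hφ w hw)
      (weightedShift φ hφ (fun x => ((d x : ℂ) - d (φ x)) * w x) hc) := by
  refine isCommutator_of fun v x => ?_
  simp only [weightedShift_apply, diagOp_apply]
  ring

/-! ### Spectral triples with diagonal Dirac operator and their square-integrable forms -/

/-- A spectral triple `(𝒜, ℓ²(X), D)` whose Dirac operator is diagonal, `D (e x) = d x • e x`:
a `*`-algebra of bounded operators having bounded commutators with `D`, such that `exp (-ε D²)` is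
of trace class for all `ε > 0`. -/
structure DiagonalSpectralTriple (X : Type*) where
  alg : StarSubalgebra ℂ (L2 X →L[ℂ] L2 X)
  eig : X → ℝ
  bounded_commutator : ∀ T ∈ alg, ∃ C, IsCommutator (diagOp eig) T C
  summable_heat : ∀ ε : ℝ, 0 < ε → Summable fun x => Real.exp (-ε * eig x ^ 2)

/-- Boundedness near `0` in `(0, ∞)`. -/
def BoundedNearZero (f : ℝ → ℂ) : Prop := ∃ C : ℝ, ∀ᶠ ε in 𝓝[>] (0 : ℝ), ‖f ε‖ ≤ C

/-- A limiting procedure `Lim_{ε → 0+}`: a positive linear functional on the functions that are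
bounded near `0` in `(0, ∞)`, equal to the limit as `ε → 0+` whenever this exists. -/
structure GeneralizedLimit where
  lim : (ℝ → ℂ) → ℂ
  lim_add : ∀ f g, BoundedNearZero f → BoundedNearZero g →
    lim (fun ε => f ε + g ε) = lim f + lim g
  lim_smul : ∀ (c : ℂ) f, BoundedNearZero f → lim (fun ε => c * f ε) = c * lim f
  lim_nonneg : ∀ f, BoundedNearZero f → (∀ᶠ ε in 𝓝[>] (0 : ℝ), 0 ≤ f ε) → 0 ≤ lim f
  lim_eq : ∀ f c, Tendsto f (𝓝[>] (0 : ℝ)) (𝓝 c) → lim f = c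

namespace DiagonalSpectralTriple

variable {X : Type*} (𝒯 : DiagonalSpectralTriple X)

/-- The derivation `a ↦ [D, a]` with values in the bounded operators. -/
def comm : 𝒯.alg →ₗ[ℂ] (L2 X →L[ℂ] L2 X) where
  toFun a := (𝒯.bounded_commutator a a.2).choose
  map_add' := by
    classical
    intro a b
    exact (𝒯.bounded_commutator _ (a + b).2).choose_spec.unique
      ((𝒯.bounded_commutator a a.2).choose_spec.add (𝒯.bounded_commutator b b.2).choose_spec)
  map_smul' := by
    classical
    intro c a
    exact (𝒯.bounded_commutator _ (c • a).2).choose_spec.unique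
      ((𝒯.bounded_commutator a a.2).choose_spec.smul c)

theorem comm_spec (a : 𝒯.alg) : IsCommutator (diagOp 𝒯.eig) a (𝒯.comm a) :=
  (𝒯.bounded_commutator a a.2).choose_spec

theorem comm_mul (a b : 𝒯.alg) : 𝒯.comm (a * b) = a * 𝒯.comm b + 𝒯.comm a * b := by
  classical
  exact (𝒯.comm_spec (a * b)).unique ((𝒯.comm_spec a).mul (𝒯.comm_spec b))

/-- The representation of the universal forms,
`a₀ (δ a₁) ⋯ (δ aₙ) ↦ a₀ [D, a₁] ⋯ [D, aₙ]`. -/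
def rep : UDGA.Omega 𝒯.alg →ₐ[ℂ] (L2 X →L[ℂ] L2 X) :=
  UDGA.lift 𝒯.alg.toSubalgebra.val 𝒯.comm 𝒯.comm_mul

variable [DecidableEq X]

/-- `Tr (T exp (-ε D²)) = ∑ₓ exp (-ε (d x)²) ⟨e x, T (e x)⟩`. -/
def heatTrace (T : L2 X →L[ℂ] L2 X) (ε : ℝ) : ℂ :=
  ∑' x, (Real.exp (-ε * 𝒯.eig x ^ 2) : ℂ) *
    ⟪lp.single (E := fun _ : X => ℂ) 2 x (1 : ℂ), T (lp.single 2 x 1)⟫_ℂ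

/-- The integral `⨍ T = Lim_{ε → 0+} Tr (T exp (-ε D²)) / Tr (exp (-ε D²))`. -/
def integral (L : GeneralizedLimit) (T : L2 X →L[ℂ] L2 X) : ℂ :=
  L.lim fun ε => 𝒯.heatTrace T ε / 𝒯.heatTrace 1 ε

/-- The sesquilinear form `(ω, η) = ⨍ π(ω)* π(η)` on universal forms. -/
def pairing (L : GeneralizedLimit) (ω η : UDGA.Omega 𝒯.alg) : ℂ :=
  𝒯.integral L (star (𝒯.rep ω) * 𝒯.rep η)

/-- The quotient `(∑ₓ exp (-ε (d x)²) ‖T (e x)‖²) / ∑ₓ exp (-ε (d x)²)`. -/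
def meanSq (T : L2 X →L[ℂ] L2 X) (ε : ℝ) : ℝ :=
  (∑' x, Real.exp (-ε * 𝒯.eig x ^ 2) * ‖T (lp.single 2 x 1)‖ ^ 2) /
    ∑' x, Real.exp (-ε * 𝒯.eig x ^ 2)

theorem heatTrace_div (T : L2 X →L[ℂ] L2 X) (ε : ℝ) :
    𝒯.heatTrace (star T * T) ε / 𝒯.heatTrace 1 ε = (𝒯.meanSq T ε : ℂ) := by
  have h1 : 𝒯.heatTrace 1 ε = ((∑' x, Real.exp (-ε * 𝒯.eig x ^ 2) : ℝ) : ℂ) := by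
    rw [heatTrace, Complex.ofReal_tsum]
    refine tsum_congr fun x => ?_
    rw [L2.inner_single]
    simp
  have h2 : 𝒯.heatTrace (star T * T) ε =
      ((∑' x, Real.exp (-ε * 𝒯.eig x ^ 2) * ‖T (lp.single 2 x 1)‖ ^ 2 : ℝ) : ℂ) := by
    rw [heatTrace, Complex.ofReal_tsum]
    refine tsum_congr fun x => ?_
    have : (star T * T) (lp.single 2 x 1) = (star T) (T (lp.single 2 x 1)) := rfl
    rw [this, ContinuousLinearMap.star_eq_adjoint, ContinuousLinearMap.adjoint_inner_right,
      inner_self_eq_norm_sq_to_K]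
    simp
  rw [h1, h2, meanSq, Complex.ofReal_div]

theorem pairing_self (L : GeneralizedLimit) (ω : UDGA.Omega 𝒯.alg) :
    𝒯.pairing L ω ω = L.lim fun ε => (𝒯.meanSq (𝒯.rep ω) ε : ℂ) := by
  simp only [pairing, integral, heatTrace_div]

theorem norm_single_le (T : L2 X →L[ℂ] L2 X) (x : X) : ‖T (lp.single 2 x 1)‖ ^ 2 ≤ ‖T‖ ^ 2 := by
  have h := T.le_opNorm (lp.single 2 x 1)
  rw [lp.norm_single (by norm_num)] at h
  have h' : ‖T (lp.single 2 x 1)‖ ≤ ‖T‖ := by simpa using h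
  gcongr

theorem summable_meanSq (T : L2 X →L[ℂ] L2 X) {ε : ℝ} (hε : 0 < ε) :
    Summable fun x => Real.exp (-ε * 𝒯.eig x ^ 2) * ‖T (lp.single 2 x 1)‖ ^ 2 := by
  refine Summable.of_nonneg_of_le (fun x => by positivity) (fun x => ?_)
    ((𝒯.summable_heat ε hε).mul_right (‖T‖ ^ 2))
  exact mul_le_mul_of_nonneg_left (norm_single_le T x) (Real.exp_nonneg _)

theorem meanSq_nonneg (T : L2 X →L[ℂ] L2 X) (ε : ℝ) : 0 ≤ 𝒯.meanSq T ε :=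
  div_nonneg (tsum_nonneg fun _ => by positivity) (tsum_nonneg fun _ => by positivity)

theorem meanSq_le (T : L2 X →L[ℂ] L2 X) {ε : ℝ} (hε : 0 < ε) : 𝒯.meanSq T ε ≤ ‖T‖ ^ 2 := by
  refine div_le_of_le_mul₀ (tsum_nonneg fun _ => by positivity) (by positivity) ?_
  rw [← tsum_mul_left]
  refine (𝒯.summable_meanSq T hε).tsum_le_tsum (fun x => ?_)
    ((𝒯.summable_heat ε hε).mul_left _)
  rw [mul_comm]
  exact mul_le_mul_of_nonneg_right (norm_single_le T x) (Real.exp_nonneg _)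

theorem meanSq_smul (c : ℂ) (T : L2 X →L[ℂ] L2 X) (ε : ℝ) :
    𝒯.meanSq (c • T) ε = ‖c‖ ^ 2 * 𝒯.meanSq T ε := by
  rw [meanSq, meanSq, ← mul_div_assoc, ← tsum_mul_left]
  congr 1
  refine tsum_congr fun x => ?_
  rw [smul_apply, norm_smul]
  ring

theorem meanSq_add_le (S T : L2 X →L[ℂ] L2 X) {ε : ℝ} (hε : 0 < ε) :
    𝒯.meanSq (S + T) ε ≤ 2 * 𝒯.meanSq S ε + 2 * 𝒯.meanSq T ε := by
  rw [meanSq, meanSq, meanSq, ← mul_div_assoc, ← mul_div_assoc, ← add_div]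
  refine div_le_div_of_nonneg_right ?_ (tsum_nonneg fun _ => by positivity)
  have hS := (𝒯.summable_meanSq S hε).mul_left 2
  have hT := (𝒯.summable_meanSq T hε).mul_left 2
  rw [← tsum_mul_left, ← tsum_mul_left, ← hS.tsum_add hT]
  refine (𝒯.summable_meanSq (S + T) hε).tsum_le_tsum (fun x => ?_) (hS.add hT)
  have h1 : ‖(S + T) (lp.single 2 x 1)‖ ^ 2 ≤
      2 * ‖S (lp.single 2 x 1)‖ ^ 2 + 2 * ‖T (lp.single 2 x 1)‖ ^ 2 := by
    have h2 := norm_add_le (S (lp.single 2 x 1)) (T (lp.single 2 x 1))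
    rw [add_apply]
    have h3 := pow_le_pow_left₀ (norm_nonneg _) h2 2
    nlinarith [sq_nonneg (‖S (lp.single 2 x 1)‖ - ‖T (lp.single 2 x 1)‖)]
  calc _ ≤ Real.exp (-ε * 𝒯.eig x ^ 2) *
        (2 * ‖S (lp.single 2 x 1)‖ ^ 2 + 2 * ‖T (lp.single 2 x 1)‖ ^ 2) := by gcongr
    _ = _ := by ring

theorem bounded_meanSq (T : L2 X →L[ℂ] L2 X) :
    BoundedNearZero fun ε => (𝒯.meanSq T ε : ℂ) := by
  refine ⟨‖T‖ ^ 2, ?_⟩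
  filter_upwards [self_mem_nhdsWithin] with ε hε
  rw [Complex.norm_real, Real.norm_of_nonneg (𝒯.meanSq_nonneg T ε)]
  exact 𝒯.meanSq_le T hε

theorem lim_meanSq_add (L : GeneralizedLimit) (S T : L2 X →L[ℂ] L2 X)
    (hS : L.lim (fun ε => (𝒯.meanSq S ε : ℂ)) = 0) (hT : L.lim (fun ε => (𝒯.meanSq T ε : ℂ)) = 0) :
    L.lim (fun ε => (𝒯.meanSq (S + T) ε : ℂ)) = 0 := by
  have bnd : ∀ (c : ℂ) (f : ℝ → ℂ), BoundedNearZero f → BoundedNearZero fun ε => c * f ε := by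
    rintro c f ⟨C, hC⟩
    refine ⟨‖c‖ * C, hC.mono fun ε h => ?_⟩
    rw [norm_mul]
    gcongr
  have bnd' : ∀ (f g : ℝ → ℂ), BoundedNearZero f → BoundedNearZero g →
      BoundedNearZero fun ε => f ε + g ε := by
    rintro f g ⟨C, hC⟩ ⟨C', hC'⟩
    refine ⟨C + C', ?_⟩
    filter_upwards [hC, hC'] with ε h h'
    exact (norm_add_le _ _).trans (add_le_add h h')
  have b1 := 𝒯.bounded_meanSq S
  have b2 := 𝒯.bounded_meanSq T
  have b3 := 𝒯.bounded_meanSq (S + T)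
  have h1 := L.lim_nonneg _ b3
    (Eventually.of_forall fun ε => by exact_mod_cast 𝒯.meanSq_nonneg _ ε)
  have h2 := L.lim_nonneg _ (bnd' _ _ (bnd' _ _ (bnd 2 _ b1) (bnd 2 _ b2)) (bnd (-1) _ b3)) (by
    filter_upwards [self_mem_nhdsWithin] with ε hε
    have := 𝒯.meanSq_add_le S T hε
    have h : (0 : ℝ) ≤ 2 * 𝒯.meanSq S ε + 2 * 𝒯.meanSq T ε + -1 * 𝒯.meanSq (S + T) ε := by
      linarith
    exact_mod_cast h)
  rw [L.lim_add _ _ (bnd' _ _ (bnd 2 _ b1) (bnd 2 _ b2)) (bnd (-1) _ b3),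
    L.lim_add _ _ (bnd 2 _ b1) (bnd 2 _ b2), L.lim_smul _ _ b1, L.lim_smul _ _ b2,
    L.lim_smul _ _ b3, hS, hT] at h2
  have h3 : L.lim (fun ε => (𝒯.meanSq (S + T) ε : ℂ)) ≤ 0 := by
    simpa using h2
  exact le_antisymm h3 h1

/-- The null forms `𝔎ₙ = {ω ∈ Ω^n(𝒜) : (ω, ω) = 0}`. -/
def null (L : GeneralizedLimit) (n : ℕ) : Submodule ℂ (UDGA.Omega 𝒯.alg) where
  carrier := {ω | ω ∈ UDGA.forms 𝒯.alg n ∧ 𝒯.pairing L ω ω = 0}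
  zero_mem' := by
    refine ⟨zero_mem _, ?_⟩
    rw [pairing_self]
    refine L.lim_eq _ _ ?_
    simp [meanSq]
  add_mem' := by
    rintro ω η ⟨h1, h2⟩ ⟨h3, h4⟩
    refine ⟨add_mem h1 h3, ?_⟩
    rw [pairing_self] at *
    rw [map_add]
    exact 𝒯.lim_meanSq_add L _ _ h2 h4
  smul_mem' := by
    rintro c ω ⟨h1, h2⟩
    refine ⟨Submodule.smul_mem _ _ h1, ?_⟩
    rw [pairing_self] at *
    have h3 := L.lim_smul (‖c‖ ^ 2) _ (𝒯.bounded_meanSq (𝒯.rep ω))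
    rw [h2, mul_zero] at h3
    rw [← h3, map_smul]
    simp [meanSq_smul]

/-- `𝔎ₙ + δ 𝔎ₙ₋₁`, where `𝔎₋₁ = 0`. -/
def relations (L : GeneralizedLimit) : ℕ → Submodule ℂ (UDGA.Omega 𝒯.alg)
  | 0 => 𝒯.null L 0
  | n + 1 => 𝒯.null L (n + 1) ⊔ (𝒯.null L n).map (UDGA.delta 𝒯.alg)

/-- The square-integrable `n`-forms `Ω̃ⁿ_D(𝒜) = Ω^n(𝒜) / (𝔎ₙ + δ 𝔎ₙ₋₁)`. -/
abbrev SqForms (L : GeneralizedLimit) (n : ℕ) : Type _ :=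
  UDGA.forms 𝒯.alg n ⧸ (𝒯.relations L n).submoduleOf (UDGA.forms 𝒯.alg n)

/-- The class in `Ω̃ⁿ_D(𝒜)` of a universal `n`-form. -/
def cls (L : GeneralizedLimit) (n : ℕ) : UDGA.forms 𝒯.alg n →ₗ[ℂ] 𝒯.SqForms L n :=
  Submodule.mkQ _

theorem delta_relations (L : GeneralizedLimit) (n : ℕ) (ω : UDGA.Omega 𝒯.alg)
    (h : ω ∈ 𝒯.relations L n) : UDGA.delta 𝒯.alg ω ∈ 𝒯.relations L (n + 1) := by
  cases n with
  | zero => exact Submodule.mem_sup_right (Submodule.mem_map_of_mem h)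
  | succ n =>
    obtain ⟨x, hx, _, ⟨y, hy, rfl⟩, rfl⟩ := Submodule.mem_sup.1 h
    rw [map_add, UDGA.delta_delta _ n y hy.1, add_zero]
    exact Submodule.mem_sup_right (Submodule.mem_map_of_mem hx)

/-- The differential `d : Ω̃ⁿ_D(𝒜) → Ω̃ⁿ⁺¹_D(𝒜)` induced by `δ`. -/
def diff (L : GeneralizedLimit) (n : ℕ) : 𝒯.SqForms L n →ₗ[ℂ] 𝒯.SqForms L (n + 1) :=
  Submodule.mapQ _ _ ((UDGA.delta 𝒯.alg).restrict (UDGA.delta_mem 𝒯.alg n))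
    (fun ω h => 𝒯.delta_relations L n ω h)

/-- The canonical map `𝒜 = Ω⁰(𝒜) → Ω̃⁰_D(𝒜)`; following it by `diff L 0` gives the
differential `d : 𝒜 → Ω̃¹_D(𝒜)`, which sends `a` to the class of `δ a`. -/
def cls₀ (L : GeneralizedLimit) (a : 𝒯.alg) : 𝒯.SqForms L 0 :=
  𝒯.cls L 0 ⟨UDGA.incl 𝒯.alg a, UDGA.incl_mem 𝒯.alg a⟩

end DiagonalSpectralTriple

/-- The bimodule structure of `Ω^n(A)`: the form `a ω b`. -/
def UDGA.biAct {A : Type*} [Ring A] [Algebra ℂ A] {n : ℕ} (a : A) (ω : UDGA.forms A n) (b : A) :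
    UDGA.forms A n :=
  ⟨UDGA.incl A a * ω * UDGA.incl A b,
    UDGA.mul_incl_mem A n b _ (UDGA.incl_mul_mem A n a _ ω.2)⟩

/-! ### The spectral triple for quantum `SU(2)` -/

namespace SUq2

/-- `α = ℓ √(1 - q^{2N}) ⊗ 1` on `ℓ²(ℕ) ⊗ ℓ²(ℤ) = ℓ²(ℕ × ℤ)`, that is
`α e_{i,j} = √(1 - q^{2i}) e_{i-1,j}`, where `e_{-1,j} = 0`. -/
def opα (q : ℝ) : L2 (ℕ × ℤ) →L[ℂ] L2 (ℕ × ℤ) :=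
  weightedShift (fun x => (x.1 + 1, x.2)) (by rintro ⟨i, j⟩ ⟨k, l⟩ h; simpa using h)
    (fun x => (√(1 - q ^ (2 * (x.1 + 1))) : ℂ))
    ⟨1, fun x => by
      rw [Complex.norm_real, Real.norm_of_nonneg (Real.sqrt_nonneg _), pow_mul]
      refine Real.sqrt_le_iff.2 ⟨zero_le_one, ?_⟩
      have : 0 ≤ (q ^ 2) ^ (x.1 + 1) := by positivity
      linarith⟩

/-- `β = q^N ⊗ ℓ`, that is `β e_{i,j} = q^i e_{i,j-1}`. -/
def opβ (q : ℝ) (hq : |q| < 1) : L2 (ℕ × ℤ) →L[ℂ] L2 (ℕ × ℤ) :=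
  weightedShift (fun x => (x.1, x.2 + 1)) (by rintro ⟨i, j⟩ ⟨k, l⟩ h; simpa using h)
    (fun x => ((q ^ x.1 : ℝ) : ℂ))
    ⟨1, fun x => by
      rw [Complex.norm_real, norm_pow]
      exact pow_le_one₀ (norm_nonneg _) hq.le⟩

/-- The eigenvalues of `D = N ⊗ S + 1 ⊗ N`, that is `D e_{i,j} = (i sgn(j) + j) e_{i,j}`, where
`sgn(j) = 1` for `j ≥ 0` and `sgn(j) = -1` for `j < 0`. -/
def eig (x : ℕ × ℤ) : ℝ := x.1 * (if 0 ≤ x.2 then 1 else -1) + x.2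

theorem eig_sq (x : ℕ × ℤ) : (x.1 : ℝ) ^ 2 + (x.2 : ℝ) ^ 2 ≤ eig x ^ 2 := by
  obtain ⟨i, j⟩ := x
  have hi : (0 : ℝ) ≤ i := Nat.cast_nonneg i
  by_cases h : 0 ≤ j
  · have hj : (0 : ℝ) ≤ j := by exact_mod_cast h
    simp only [eig, h, if_true]
    nlinarith [mul_nonneg hi hj]
  · have hj : (j : ℝ) ≤ 0 := by exact_mod_cast (not_le.1 h).le
    simp only [eig, h, if_false]
    nlinarith [mul_nonneg hi (neg_nonneg.2 hj)]

theorem summable_nat (ε : ℝ) (hε : 0 < ε) : Summable fun i : ℕ => Real.exp (-ε * (i : ℝ) ^ 2) := by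
  refine Summable.of_nonneg_of_le (fun i => by positivity) (fun i => ?_)
    (Real.summable_exp_nat_mul_iff.2 (neg_lt_zero.2 hε))
  rw [Real.exp_le_exp]
  have : (i : ℝ) ≤ (i : ℝ) ^ 2 := by exact_mod_cast Nat.le_self_pow (by norm_num) i
  nlinarith

theorem summable_heat (ε : ℝ) (hε : 0 < ε) :
    Summable fun x : ℕ × ℤ => Real.exp (-ε * eig x ^ 2) := by
  have h1 := summable_nat ε hε
  have h2 : Summable fun j : ℤ => Real.exp (-ε * (j : ℝ) ^ 2) := by
    refine Summable.of_nat_of_neg ?_ ?_ <;> simpa using h1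
  have h3 := h1.mul_of_nonneg h2 (fun _ => by positivity) (fun _ => by positivity)
  refine Summable.of_nonneg_of_le (fun x => by positivity) (fun x => ?_) h3
  rw [← Real.exp_add, Real.exp_le_exp]
  nlinarith [eig_sq x]

theorem commutator_α (q : ℝ) : ∃ C, IsCommutator (diagOp eig) (opα q) C := by
  refine ⟨_, isCommutator_weightedShift _ _ _ _ ⟨1, fun x => ?_⟩⟩
  have h1 : ‖(eig x : ℂ) - eig (x.1 + 1, x.2)‖ = 1 := by
    rw [← Complex.ofReal_sub, Complex.norm_real, eig, eig]
    split_ifs <;> simp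
  rw [norm_mul, h1, one_mul, Complex.norm_real, Real.norm_of_nonneg (Real.sqrt_nonneg _),
    pow_mul]
  refine Real.sqrt_le_iff.2 ⟨zero_le_one, ?_⟩
  have : 0 ≤ (q ^ 2) ^ (x.1 + 1) := by positivity
  linarith

theorem commutator_β (q : ℝ) (hq : |q| < 1) : ∃ C, IsCommutator (diagOp eig) (opβ q hq) C := by
  have ht := tendsto_self_mul_const_pow_of_abs_lt_one (r := |q|) (by rwa [abs_abs])
  obtain ⟨M, hM⟩ := ht.bddAbove_range
  refine ⟨_, isCommutator_weightedShift _ _ _ _ ⟨2 * M + 1, fun x => ?_⟩⟩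
  have h1 : ‖(eig x : ℂ) - eig (x.1, x.2 + 1)‖ ≤ 2 * x.1 + 1 := by
    rw [← Complex.ofReal_sub, Complex.norm_real, eig, eig, Real.norm_eq_abs, abs_le]
    have : (0 : ℝ) ≤ x.1 := Nat.cast_nonneg _
    push_cast
    split_ifs <;> first | omega | (constructor <;> linarith)
  have h2 : ‖((q ^ x.1 : ℝ) : ℂ)‖ = |q| ^ x.1 := by
    rw [Complex.norm_real, norm_pow, Real.norm_eq_abs]
  have h3 : (x.1 : ℝ) * |q| ^ x.1 ≤ M := hM ⟨x.1, rfl⟩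
  have h4 : |q| ^ x.1 ≤ 1 := pow_le_one₀ (abs_nonneg _) hq.le
  rw [norm_mul, h2]
  calc _ ≤ (2 * (x.1 : ℝ) + 1) * |q| ^ x.1 := by gcongr
    _ ≤ 2 * M + 1 := by linarith

/-- The spectral triple `(𝒜_f, ℓ²(ℕ × ℤ), D)`, where `𝒜_f` is the `*`-algebra generated by `α`
and `β`. -/
def triple (q : ℝ) (hq : |q| < 1) : DiagonalSpectralTriple (ℕ × ℤ) where
  alg := StarAlgebra.adjoin ℂ {opα q, opβ q hq}
  eig := eig
  bounded_commutator := by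
    intro T hT
    induction hT using StarAlgebra.adjoin_induction with
    | mem x hx =>
      rcases hx with rfl | rfl
      · exact commutator_α q
      · exact commutator_β q hq
    | algebraMap r => exact ⟨_, isCommutator_algebraMap r⟩
    | add x y _ _ hx hy => exact ⟨_, hx.choose_spec.add hy.choose_spec⟩
    | mul x y _ _ hx hy => exact ⟨_, hx.choose_spec.mul hy.choose_spec⟩
    | star x _ hx => exact ⟨_, hx.choose_spec.star⟩
  summable_heat := summable_heat

/-- The algebra `𝒜_f`. -/
abbrev Af (q : ℝ) (hq : |q| < 1) : Type := (triple q hq).alg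

/-- The element `α` of `𝒜_f`. -/
def α (q : ℝ) (hq : |q| < 1) : Af q hq :=
  ⟨opα q, StarAlgebra.subset_adjoin ℂ _ (by simp)⟩

/-- The element `β` of `𝒜_f`. -/
def β (q : ℝ) (hq : |q| < 1) : Af q hq :=
  ⟨opβ q hq, StarAlgebra.subset_adjoin ℂ _ (by simp)⟩

/-- `α_i = α^i` for `i ≥ 0` and `α_i = (α*)^{-i}` for `i < 0`. -/
def αpow (q : ℝ) (hq : |q| < 1) (i : ℤ) : Af q hq :=
  if 0 ≤ i then α q hq ^ i.toNat else star (α q hq) ^ (-i).toNat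

/-- The element `α_i β^j β*^k` of `𝒜_f`. -/
def monomial (q : ℝ) (hq : |q| < 1) (i : ℤ) (j k : ℕ) : Af q hq :=
  αpow q hq i * β q hq ^ j * star (β q hq) ^ k

end SUq2

end

/-! Every operator that occurs has a simple asymptotic form far out in the direction `i → ∞`,
uniformly in `j`, and the heat average sees nothing else. There `α` becomes the shift `e_{i,j} ↦
e_{i-1,j}` and `β` disappears like `q^i`. Hence each `a ∈ 𝒜_f` acts asymptotically as a Laurent
polynomial `σ(a)` in the shift. Shifting `i` by `-k` changes the eigenvalue of `D` by `-k sgn(j)`,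
so `[D, a]` acts asymptotically as `sgn(j)` times `-z d/dz σ(a)`. For `β` the eigenvalue may jump by
as much as `2i + 1`, but `i q^i → 0`. Asymptotic forms multiply, so an `n`-form `ω` acts
asymptotically as `sgn(j)ⁿ` times a Laurent polynomial, its symbol (`hasSymbol_rep`).

A row of fixed `i` has heat weight at most `2 θ(ε)` with `θ(ε) = ∑ exp (-ε m²)`, while the total
weight eventually exceeds `M θ(ε)` for any given `M`. Averages of bounded functions therefore
converge to their limit as `i → ∞` (`tendsto_heat_average`). So `(ω, ω)_D` is a genuine limit, the
sum of the squared moduli of the coefficients of the symbol, whatever `Lim` is. The null forms are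
exactly the forms with symbol `0` (`mem_null_iff`).

What remains is algebra. In degrees `0` and `1` the relations are the kernel of the symbol map,
since the symbol of `δ a` depends only on `σ(a)`, and the symbol map is onto. From degree `2` on,
the differentials of null forms already attain every symbol (`exists_null_delta_eq`). Each form then
differs from such a differential by a null form, and the quotient vanishes. -/

/-! ### Linear maps on Laurent polynomials -/

namespace LaurentPolynomial

/-- The linear map sending `z ^ k` to `v k`. -/
noncomputable def lsum {M : Type*} [AddCommGroup M] [Module ℂ M] (v : ℤ → M) :
    LaurentPolynomial ℂ →ₗ[ℂ] M :=
  Finsupp.linearCombination ℂ v ∘ₗ (AddMonoidAlgebra.coeffLinearEquiv ℂ).toLinearMap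

theorem lsum_apply {M : Type*} [AddCommGroup M] [Module ℂ M] (v : ℤ → M)
    (p : LaurentPolynomial ℂ) : lsum v p = ∑ k ∈ p.coeff.support, p.coeff k • v k := rfl

@[simp]
theorem lsum_T {M : Type*} [AddCommGroup M] [Module ℂ M] (v : ℤ → M) (k : ℤ) :
    lsum v (T k) = v k := by
  change Finsupp.linearCombination ℂ v (Finsupp.single k 1) = v k
  simp

theorem induction_linear {P : LaurentPolynomial ℂ → Prop} (p : LaurentPolynomial ℂ)
    (add : ∀ p q, P p → P q → P (p + q)) (smul : ∀ (c : ℂ) (k : ℤ), P (c • T k)) : P p :=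
  LaurentPolynomial.induction_on' p add fun k c => by
    rw [← smul_eq_C_mul]
    exact smul c k

/-- The derivation `-z d/dz` of the Laurent polynomials. -/
noncomputable def negEuler : LaurentPolynomial ℂ →ₗ[ℂ] LaurentPolynomial ℂ :=
  lsum fun k => (-(k : ℂ)) • T k

@[simp]
theorem negEuler_T (k : ℤ) : negEuler (T k) = (-(k : ℂ)) • T k := lsum_T _ _

theorem negEuler_mul (p r : LaurentPolynomial ℂ) :
    negEuler (p * r) = p * negEuler r + negEuler p * r := by
  induction p using induction_linear with
  | add p₁ p₂ h₁ h₂ => rw [add_mul, map_add, h₁, h₂, map_add]; ring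
  | smul c k =>
    induction r using induction_linear with
    | add r₁ r₂ h₁ h₂ => rw [mul_add, map_add, h₁, h₂, map_add]; ring
    | smul c' l =>
      simp only [smul_mul_smul_comm, ← T_add, map_smul, negEuler_T, ← add_smul, smul_smul]
      congr 1
      push_cast
      ring

end LaurentPolynomial

/-! ### Asymptotic symbols of operators on `ℓ²(ℕ × ℤ)` -/

namespace SUq2

open LaurentPolynomial

/-- The canonical basis vector `e x`. -/
noncomputable abbrev basisVec (x : ℕ × ℤ) : L2 (ℕ × ℤ) := lp.single 2 x 1

theorem norm_basisVec (x : ℕ × ℤ) : ‖basisVec x‖ = 1 := by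
  rw [lp.norm_single (by norm_num)]; simp

theorem basisVec_apply (x y : ℕ × ℤ) : basisVec x y = if y = x then 1 else 0 := by
  by_cases h : y = x
  · subst h; simp
  · simp [h]

/-- The index `(i - k, j)`, with `i - k` truncated at `0`. -/
def shiftLeft (k : ℤ) (x : ℕ × ℤ) : ℕ × ℤ := (((x.1 : ℤ) - k).toNat, x.2)

/-- The filter of the sets that contain all `(i, j)` with `i` large. -/
def fstTop : Filter (ℕ × ℤ) := comap Prod.fst atTop

instance : NeBot fstTop := by
  rw [fstTop, comap_neBot_iff_frequently]
  exact Frequently.of_forall fun i => ⟨(i, 0), rfl⟩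

theorem tendsto_fst : Tendsto Prod.fst fstTop atTop := tendsto_comap

theorem eventually_fst_ge (k : ℤ) : ∀ᶠ x in fstTop, k ≤ (x.1 : ℤ) :=
  (tendsto_natCast_atTop_atTop.comp tendsto_fst).eventually_ge_atTop k

theorem tendsto_shiftLeft (k : ℤ) : Tendsto (shiftLeft k) fstTop fstTop := by
  refine tendsto_comap_iff.2 (tendsto_atTop.2 fun n => ?_)
  filter_upwards [eventually_fst_ge (n + k)] with x hx
  simp only [Function.comp, shiftLeft]
  omega

/-- Shifts compose additively only when the first one is not truncated at `0`, which is why this is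
an eventual statement. -/
theorem shiftLeft_shiftLeft (k l : ℤ) :
    ∀ᶠ x in fstTop, shiftLeft l (shiftLeft k x) = shiftLeft (l + k) x := by
  filter_upwards [eventually_fst_ge k] with x hx
  simp only [shiftLeft, Prod.mk.injEq, and_true]
  omega

/-- The vector `∑ₖ pₖ e_{i-k,j}`, where `p = ∑ₖ pₖ z ^ k`. -/
noncomputable def shiftSum (x : ℕ × ℤ) : LaurentPolynomial ℂ →ₗ[ℂ] L2 (ℕ × ℤ) :=
  lsum fun k => basisVec (shiftLeft k x)

@[simp]
theorem shiftSum_T (x : ℕ × ℤ) (k : ℤ) : shiftSum x (T k) = basisVec (shiftLeft k x) :=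
  lsum_T _ _

theorem shiftSum_shiftLeft (k : ℤ) (p : LaurentPolynomial ℂ) :
    ∀ᶠ x in fstTop, shiftSum (shiftLeft k x) p = shiftSum x (p * T k) := by
  induction p using LaurentPolynomial.induction_linear with
  | add p r hp hr =>
    filter_upwards [hp, hr] with x h₁ h₂
    rw [map_add, h₁, h₂, add_mul, map_add]
  | smul c l =>
    filter_upwards [shiftLeft_shiftLeft k l] with x hx
    rw [smul_mul_assoc, ← T_add, map_smul, map_smul, shiftSum_T, shiftSum_T, hx]

/-- Once `i` is at least every exponent of `p`, no shift is truncated, so the basis vectors involved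
are distinct and Pythagoras applies. -/
theorem norm_sq_shiftSum (p : LaurentPolynomial ℂ) :
    ∀ᶠ x in fstTop, ‖shiftSum x p‖ ^ 2 = ∑ k ∈ p.coeff.support, ‖p.coeff k‖ ^ 2 := by
  have h : ∀ᶠ x in fstTop, ∀ k ∈ p.coeff.support, k ≤ (x.1 : ℤ) :=
    (Finset.eventually_all _).2 fun k _ => eventually_fst_ge k
  filter_upwards [h] with x hx
  have key : ∀ k ∈ p.coeff.support, ∀ l ∈ p.coeff.support,
      ⟪basisVec (shiftLeft k x), basisVec (shiftLeft l x)⟫_ℂ = if k = l then 1 else 0 := by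
    intro k hk l hl
    rw [L2.inner_single, basisVec_apply, map_one, one_mul]
    refine if_congr ?_ rfl rfl
    have h1 := hx k hk
    have h2 := hx l hl
    simp only [shiftLeft, Prod.mk.injEq, and_true]
    omega
  have h2 : ((‖shiftSum x p‖ ^ 2 : ℝ) : ℂ) =
      ((∑ k ∈ p.coeff.support, ‖p.coeff k‖ ^ 2 : ℝ) : ℂ) := by
    have h3 := inner_self_eq_norm_sq_to_K (𝕜 := ℂ) (shiftSum x p)
    push_cast
    refine (Eq.symm h3).trans ?_
    rw [shiftSum, lsum_apply, sum_inner]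
    refine Finset.sum_congr rfl fun k hk => ?_
    rw [inner_sum, Finset.sum_eq_single_of_mem k hk]
    · rw [inner_smul_left, inner_smul_right, key k hk k hk, if_pos rfl, mul_one,
        Complex.conj_mul']
    · intro l hl hlk
      rw [inner_smul_left, inner_smul_right, key k hk l hl, if_neg (Ne.symm hlk)]
      simp
  exact_mod_cast h2

/-- `sgn(j)`. -/
def sgn (x : ℕ × ℤ) : ℂ := if 0 ≤ x.2 then 1 else -1

theorem norm_sgn_pow (x : ℕ × ℤ) (n : ℕ) : ‖sgn x ^ n‖ = 1 := by
  rw [norm_pow, sgn]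
  split_ifs <;> simp

/-- `T` is asymptotic, as `i → ∞`, to `e_{i,j} ↦ sgn(j)ⁿ ∑ₖ pₖ e_{i-k,j}`, uniformly in `j`. -/
def HasSymbol (n : ℕ) (A : L2 (ℕ × ℤ) →L[ℂ] L2 (ℕ × ℤ)) (p : LaurentPolynomial ℂ) : Prop :=
  Tendsto (fun x => A (basisVec x) - sgn x ^ n • shiftSum x p) fstTop (𝓝 0)

/-! ### Calculus of symbols: linearity, products, norms and uniqueness. -/

variable {n m : ℕ} {A B : L2 (ℕ × ℤ) →L[ℂ] L2 (ℕ × ℤ)} {p r : LaurentPolynomial ℂ}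

theorem HasSymbol.zero (n : ℕ) : HasSymbol n 0 0 := by
  simp [HasSymbol]

theorem HasSymbol.one : HasSymbol 0 1 1 := by
  have : ∀ x, (1 : L2 (ℕ × ℤ) →L[ℂ] L2 (ℕ × ℤ)) (basisVec x) - sgn x ^ 0 • shiftSum x 1 = 0 := by
    intro x
    rw [← T_zero, shiftSum_T]
    simp [shiftLeft]
  simp only [HasSymbol, this]
  exact tendsto_const_nhds

theorem HasSymbol.add (hA : HasSymbol n A p) (hB : HasSymbol n B r) :
    HasSymbol n (A + B) (p + r) := by
  have := Tendsto.add hA hB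
  rw [add_zero] at this
  refine this.congr fun x => ?_
  rw [map_add, smul_add, add_apply]
  abel

theorem HasSymbol.smul (c : ℂ) (hA : HasSymbol n A p) : HasSymbol n (c • A) (c • p) := by
  have := Tendsto.const_smul hA c
  rw [smul_zero] at this
  refine this.congr fun x => ?_
  rw [map_smul, smul_sub, smul_apply, smul_comm]

/-- By linearity it is enough to treat `r = z ^ k`. Then the asymptotics of `A` are used at the
shifted index, whose first coordinate still tends to infinity and whose sign is unchanged. -/
theorem HasSymbol.tendsto_apply_shiftSum (hA : HasSymbol n A p) (r : LaurentPolynomial ℂ) :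
    Tendsto (fun x => A (shiftSum x r) - sgn x ^ n • shiftSum x (p * r)) fstTop (𝓝 0) := by
  induction r using LaurentPolynomial.induction_linear with
  | add r₁ r₂ h₁ h₂ =>
    have := h₁.add h₂
    rw [add_zero] at this
    refine this.congr fun x => ?_
    rw [mul_add, map_add, map_add, map_add, smul_add]
    abel
  | smul c k =>
    have := (Tendsto.comp hA (tendsto_shiftLeft k)).const_smul c
    rw [smul_zero] at this
    refine this.congr' ?_
    filter_upwards [shiftSum_shiftLeft k p] with x hx
    have hs : sgn (shiftLeft k x) = sgn x := rfl
    simp only [Function.comp, hx, hs]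
    rw [mul_smul_comm, map_smul, map_smul, map_smul, shiftSum_T, smul_sub, smul_comm c]

theorem tendsto_sgn_pow_smul (n : ℕ) {f : ℕ × ℤ → L2 (ℕ × ℤ)} (hf : Tendsto f fstTop (𝓝 0)) :
    Tendsto (fun x => sgn x ^ n • f x) fstTop (𝓝 0) := by
  rw [tendsto_zero_iff_norm_tendsto_zero] at *
  refine hf.congr fun x => ?_
  rw [norm_smul, norm_sgn_pow, one_mul]

/-- Continuity of `A` carries the error of `B` to an error tending to `0`; the main term of `B` is a
finite combination of basis vectors, to which `HasSymbol.tendsto_apply_shiftSum` applies. The signs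
multiply because shifts in `i` leave `j` alone. -/
theorem HasSymbol.mul (hA : HasSymbol n A p) (hB : HasSymbol m B r) {l : ℕ}
    (hl : n + m = l) : HasSymbol l (A * B) (p * r) := by
  subst hl
  have h₁ := (A.continuous.tendsto 0).comp hB
  rw [map_zero] at h₁
  have := h₁.add (tendsto_sgn_pow_smul m (hA.tendsto_apply_shiftSum r))
  rw [add_zero] at this
  refine this.congr fun x => ?_
  have : (A * B) (basisVec x) = A (B (basisVec x)) := rfl
  rw [this, Function.comp, map_sub, map_smul, smul_sub, smul_smul, ← pow_add, add_comm m n]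
  abel

theorem HasSymbol.tendsto_norm_sq (hA : HasSymbol n A p) :
    Tendsto (fun x => ‖A (basisVec x)‖ ^ 2) fstTop
      (𝓝 (∑ k ∈ p.coeff.support, ‖p.coeff k‖ ^ 2)) := by
  set c := ∑ k ∈ p.coeff.support, ‖p.coeff k‖ ^ 2
  have h₁ : Tendsto (fun x => ‖sgn x ^ n • shiftSum x p‖) fstTop (𝓝 √c) := by
    refine tendsto_const_nhds.congr' ?_
    filter_upwards [norm_sq_shiftSum p] with x hx
    rw [norm_smul, norm_sgn_pow, one_mul, ← Real.sqrt_sq (norm_nonneg (shiftSum x p)), hx]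
  have h₂ : Tendsto (fun x => ‖A (basisVec x)‖ - ‖sgn x ^ n • shiftSum x p‖) fstTop (𝓝 0) :=
    squeeze_zero_norm (fun x => abs_norm_sub_norm_le _ _)
      (tendsto_zero_iff_norm_tendsto_zero.1 hA)
  have h₃ := (h₂.add h₁).pow 2
  rw [zero_add, Real.sq_sqrt (Finset.sum_nonneg fun _ _ => by positivity)] at h₃
  simpa using h₃

theorem sum_norm_sq_coeff_eq_zero (p : LaurentPolynomial ℂ) :
    ∑ k ∈ p.coeff.support, ‖p.coeff k‖ ^ 2 = 0 ↔ p = 0 := by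
  refine ⟨fun h => ?_, fun h => by simp [h]⟩
  rw [Finset.sum_eq_zero_iff_of_nonneg fun _ _ => by positivity] at h
  ext k
  by_contra hk
  exact hk (by simpa using h k (Finsupp.mem_support_iff.2 hk))

/-- The zero operator `A - A` has symbol `p - r`, so the `ℓ²`-norm of the coefficients of `p - r` is
a limit of zeros. -/
theorem HasSymbol.unique (hA : HasSymbol n A p) (hB : HasSymbol n A r) : p = r := by
  have h := (hA.add (hB.smul (-1))).tendsto_norm_sq
  have h0 : A + (-1 : ℂ) • A = 0 := by simp
  simp only [h0, zero_apply, norm_zero] at h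
  have h1 := tendsto_nhds_unique h tendsto_const_nhds
  rw [zero_pow two_ne_zero, sum_norm_sq_coeff_eq_zero, neg_one_smul, add_neg_eq_zero] at h1
  exact h1

end SUq2

/-! ### Averages with respect to the heat weights -/

namespace SUq2

/-- The theta sum `∑ₘ exp (-ε m²)`. -/
noncomputable def halfTheta (ε : ℝ) : ℝ := ∑' m : ℕ, Real.exp (-ε * (m : ℝ) ^ 2)

/-- The first `n` terms already tend to `n` as `ε → 0`. -/
theorem tendsto_halfTheta : Tendsto halfTheta (𝓝[>] 0) atTop := by
  refine tendsto_atTop.2 fun b => ?_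
  obtain ⟨n, hn⟩ := exists_nat_gt b
  have h₁ : Tendsto (fun ε : ℝ => ∑ m ∈ Finset.range n, Real.exp (-ε * (m : ℝ) ^ 2)) (𝓝[>] 0)
      (𝓝 (∑ m ∈ Finset.range n, Real.exp (-0 * (m : ℝ) ^ 2))) := by
    refine Tendsto.mono_left (Continuous.tendsto ?_ 0) nhdsWithin_le_nhds
    fun_prop
  have h₂ : b < ∑ m ∈ Finset.range n, Real.exp (-0 * (m : ℝ) ^ 2) := by simpa using hn
  filter_upwards [h₁.eventually (lt_mem_nhds h₂), self_mem_nhdsWithin] with ε h hε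
  exact h.le.trans ((summable_nat ε hε).sum_le_tsum _ fun _ _ => by positivity)

/-- The heat weight of the row `{(i, j) : j ∈ ℤ}`. -/
noncomputable def rowWeight (ε : ℝ) (i : ℕ) : ℝ := ∑' j : ℤ, Real.exp (-ε * eig (i, j) ^ 2)

variable {ε : ℝ}

/-- Passing to the tail removes `i` terms, each between `0` and `1`. -/
theorem tail_halfTheta (hε : 0 < ε) (i : ℕ) :
    halfTheta ε - i ≤ ∑' m : ℕ, Real.exp (-ε * ((m + i : ℕ) : ℝ) ^ 2) ∧
      ∑' m : ℕ, Real.exp (-ε * ((m + i : ℕ) : ℝ) ^ 2) ≤ halfTheta ε := by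
  have h := (summable_nat ε hε).sum_add_tsum_nat_add i
  have h₁ : ∑ m ∈ Finset.range i, Real.exp (-ε * (m : ℝ) ^ 2) ≤ i := by
    refine (Finset.sum_le_card_nsmul _ _ 1 fun m _ => ?_).trans (by simp)
    rw [Real.exp_le_one_iff, neg_mul, neg_nonpos]
    positivity
  have h₂ : 0 ≤ ∑ m ∈ Finset.range i, Real.exp (-ε * (m : ℝ) ^ 2) :=
    Finset.sum_nonneg fun _ _ => by positivity
  rw [halfTheta]
  constructor <;> linarith

/-- The sign in `D` makes `|i sgn(j) + j| = i + |j|`, so the row consists of two tails of the theta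
sum. They start at `i` for `j ≥ 0` and at `i + 1` for `j < 0`. -/
theorem rowWeight_eq (hε : 0 < ε) (i : ℕ) :
    rowWeight ε i = ∑' m : ℕ, Real.exp (-ε * ((m + i : ℕ) : ℝ) ^ 2) +
      ∑' m : ℕ, Real.exp (-ε * ((m + (i + 1) : ℕ) : ℝ) ^ 2) := by
  have hs : ∀ k : ℕ, Summable fun m : ℕ => Real.exp (-ε * ((m + k : ℕ) : ℝ) ^ 2) :=
    fun k => (summable_nat_add_iff k).2 (summable_nat ε hε)
  have h₁ : ∀ m : ℕ, Real.exp (-ε * eig (i, (m : ℤ)) ^ 2) =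
      Real.exp (-ε * ((m + i : ℕ) : ℝ) ^ 2) := by
    intro m
    congr 2
    simp [eig, add_comm]
  have h₂ : ∀ m : ℕ, Real.exp (-ε * eig (i, -((m : ℤ) + 1)) ^ 2) =
      Real.exp (-ε * ((m + (i + 1) : ℕ) : ℝ) ^ 2) := by
    intro m
    have : ¬ (0 : ℤ) ≤ -((m : ℤ) + 1) := by omega
    simp only [eig, if_neg this]
    congr 2
    push_cast
    ring
  rw [rowWeight, tsum_of_nat_of_neg_add_one (by simpa only [h₁] using hs i)
    (by simpa only [h₂] using hs (i + 1))]
  simp only [h₁, h₂]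

theorem rowWeight_le (hε : 0 < ε) (i : ℕ) : rowWeight ε i ≤ 2 * halfTheta ε := by
  rw [rowWeight_eq hε]
  linarith [(tail_halfTheta hε i).2, (tail_halfTheta hε (i + 1)).2]

theorem le_rowWeight (hε : 0 < ε) (i : ℕ) :
    2 * halfTheta ε - 2 * (i + 1) ≤ rowWeight ε i := by
  rw [rowWeight_eq hε]
  have h₁ := (tail_halfTheta hε i).1
  have h₂ := (tail_halfTheta hε (i + 1)).1
  push_cast at h₁ h₂ ⊢
  linarith

/-! ### Concentration of the heat average at large `i`. -/

theorem summable_heat_mul (hε : 0 < ε) {f : ℕ × ℤ → ℝ} {C : ℝ} (hf : ∀ x, |f x| ≤ C) :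
    Summable fun x => Real.exp (-ε * eig x ^ 2) * f x := by
  refine Summable.of_norm_bounded ((summable_heat ε hε).mul_right C) fun x => ?_
  rw [norm_mul, Real.norm_of_nonneg (Real.exp_nonneg _)]
  gcongr
  exact hf x

theorem tsum_strip (hε : 0 < ε) (N : ℕ) :
    ∑' x : ℕ × ℤ, Real.exp (-ε * eig x ^ 2) * (if x.1 < N then 1 else 0) =
      ∑ i ∈ Finset.range N, rowWeight ε i := by
  rw [Summable.tsum_prod (summable_heat_mul hε (C := 1) fun x => by split_ifs <;> simp),
    tsum_eq_sum (s := Finset.range N)]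
  · refine Finset.sum_congr rfl fun i hi => ?_
    simp [rowWeight, Finset.mem_range.1 hi]
  · intro i hi
    simp [mt Finset.mem_range.2 hi]

theorem tsum_heat_ge (hε : 0 < ε) (M : ℕ) :
    M * (2 * halfTheta ε - 2 * M) ≤ ∑' x : ℕ × ℤ, Real.exp (-ε * eig x ^ 2) := by
  calc M * (2 * halfTheta ε - 2 * M)
      = ∑ _i ∈ Finset.range M, (2 * halfTheta ε - 2 * M) := by
        rw [Finset.sum_const, Finset.card_range, nsmul_eq_mul]
    _ ≤ ∑ i ∈ Finset.range M, rowWeight ε i := by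
        refine Finset.sum_le_sum fun i hi => le_trans ?_ (le_rowWeight hε i)
        have : (i : ℝ) + 1 ≤ M := by exact_mod_cast Finset.mem_range.1 hi
        linarith
    _ ≤ _ := by
        rw [← tsum_strip hε]
        refine (summable_heat_mul hε (C := 1) fun x => by split_ifs <;> simp).tsum_le_tsum
          (fun x => ?_) (summable_heat ε hε)
        refine mul_le_of_le_one_right (Real.exp_nonneg _) ?_
        split_ifs <;> simp

theorem tsum_heat_pos (hε : 0 < ε) : 0 < ∑' x : ℕ × ℤ, Real.exp (-ε * eig x ^ 2) :=
  (summable_heat ε hε).tsum_pos (fun _ => by positivity) (0, 0) (Real.exp_pos _)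

/-- Finitely many rows carry a vanishing fraction of the total weight: they weigh `O(θ(ε))`, while
the total exceeds any fixed multiple of `θ(ε)` for small `ε`. Outside these rows `f` is uniformly
close to `c`. -/
theorem tendsto_heat_average {f : ℕ × ℤ → ℝ} {C c : ℝ} (hC : ∀ x, |f x| ≤ C)
    (hf : Tendsto f fstTop (𝓝 c)) :
    Tendsto (fun ε => (∑' x, Real.exp (-ε * eig x ^ 2) * f x) /
      ∑' x, Real.exp (-ε * eig x ^ 2)) (𝓝[>] 0) (𝓝 c) := by
  have hC0 : 0 ≤ C := (abs_nonneg _).trans (hC (0, 0))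
  rw [Metric.tendsto_nhds]
  intro δ hδ
  have hev : ∀ᶠ x in fstTop, |f x - c| < δ / 2 := by
    simpa [Real.dist_eq] using Metric.tendsto_nhds.1 hf (δ / 2) (by positivity)
  obtain ⟨t, ht, hts⟩ := mem_comap.1 hev
  obtain ⟨N, hN⟩ := mem_atTop_sets.1 ht
  set K := C + |c|
  have hK : ∀ x, |f x - c| ≤ K := fun x => (abs_sub _ _).trans (add_le_add (hC x) le_rfl)
  have hK0 : 0 ≤ K := by positivity
  -- The strip `i < N` contributes at most `2 K N θ(ε)`. This `M` makes that less than `(δ / 2) M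
  -- θ(ε)`, hence less than `δ / 2` times the total weight.
  obtain ⟨M, hM⟩ := exists_nat_gt (4 * K * N / δ)
  rw [div_lt_iff₀ hδ] at hM
  -- The bound `θ(ε) ≥ 2 M` turns `M (2 θ(ε) - 2 M)` from `tsum_heat_ge` into at least `M θ(ε)`.
  filter_upwards [self_mem_nhdsWithin, tendsto_halfTheta.eventually_ge_atTop (2 * M),
    tendsto_halfTheta.eventually_gt_atTop 0] with ε hε hG hG0
  have hZ := tsum_heat_pos hε
  have hge := tsum_heat_ge hε M
  set Z := ∑' x : ℕ × ℤ, Real.exp (-ε * eig x ^ 2) with hZdef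
  have hs := summable_heat_mul hε hC
  have hs' := (summable_heat ε hε).mul_right c
  have hind : Summable fun x : ℕ × ℤ =>
      Real.exp (-ε * eig x ^ 2) * (if x.1 < N then (1 : ℝ) else 0) :=
    summable_heat_mul hε (C := 1) fun x => by split_ifs <;> simp
  have hdiff : (∑' x, Real.exp (-ε * eig x ^ 2) * f x) / Z - c =
      (∑' x, Real.exp (-ε * eig x ^ 2) * (f x - c)) / Z := by
    rw [eq_div_iff hZ.ne', sub_mul, div_mul_cancel₀ _ hZ.ne', mul_comm c, hZdef, ← tsum_mul_right,
      ← hs.tsum_sub hs']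
    simp only [mul_sub]
  -- Pointwise, `|f - c|` is at most `K` on the strip `i < N` and less than `δ / 2` off it.
  have hbound : |∑' x, Real.exp (-ε * eig x ^ 2) * (f x - c)| ≤
      Z * (δ / 2) + (∑ i ∈ Finset.range N, rowWeight ε i) * K := by
    rw [← tsum_strip hε, hZdef, ← tsum_mul_right, ← tsum_mul_right,
      ← ((summable_heat ε hε).mul_right _).tsum_add (hind.mul_right K), ← Real.norm_eq_abs]
    refine tsum_of_norm_bounded
      (((summable_heat ε hε).mul_right _).add (hind.mul_right K)).hasSum fun x => ?_
    rw [norm_mul, Real.norm_of_nonneg (Real.exp_nonneg _), mul_assoc, ← mul_add]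
    gcongr
    by_cases hx : x.1 < N
    · simp only [if_pos hx, one_mul]
      exact (hK x).trans (by linarith)
    · simp only [if_neg hx, zero_mul, add_zero]
      exact (hts (hN x.1 (not_lt.1 hx)) : |f x - c| < δ / 2).le
  have hrow : ∑ i ∈ Finset.range N, rowWeight ε i ≤ N * (2 * halfTheta ε) := by
    refine (Finset.sum_le_card_nsmul _ _ _ fun i _ => rowWeight_le hε i).trans (by simp)
  rw [Real.dist_eq, hdiff, abs_div, abs_of_pos hZ, div_lt_iff₀ hZ]
  have h₁ : M * halfTheta ε ≤ Z := by
    refine le_trans ?_ hge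
    gcongr
    linarith
  have h₂ : (∑ i ∈ Finset.range N, rowWeight ε i) * K ≤ N * (2 * halfTheta ε) * K := by gcongr
  have h₃ := mul_lt_mul_of_pos_right hM hG0
  have h₄ := mul_le_mul_of_nonneg_right h₁ hδ.le
  linarith

end SUq2

/-! ### Symbols of the generators -/

namespace SUq2

open LaurentPolynomial

theorem weightedShift_basisVec {φ : ℕ × ℤ → ℕ × ℤ} (hφ : Function.Injective φ) {w : ℕ × ℤ → ℂ}
    (hw : ∃ C : ℝ, ∀ x, ‖w x‖ ≤ C) (x : ℕ × ℤ) :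
    weightedShift φ hφ w hw (basisVec (φ x)) = w x • basisVec x := by
  ext y
  rw [weightedShift_apply, lp.coeFn_smul, Pi.smul_apply, basisVec_apply, basisVec_apply]
  by_cases h : y = x
  · simp [h]
  · simp [h, hφ.ne h]

theorem star_weightedShift_basisVec {φ : ℕ × ℤ → ℕ × ℤ} (hφ : Function.Injective φ)
    {w : ℕ × ℤ → ℂ} (hw : ∃ C : ℝ, ∀ x, ‖w x‖ ≤ C) (x : ℕ × ℤ) :
    star (weightedShift φ hφ w hw) (basisVec x) = (starRingEnd ℂ) (w x) • basisVec (φ x) := by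
  ext y
  have h₁ : star (weightedShift φ hφ w hw) (basisVec x) y =
      ⟪basisVec y, star (weightedShift φ hφ w hw) (basisVec x)⟫_ℂ := by
    rw [L2.inner_single, map_one, one_mul]
  rw [h₁, ContinuousLinearMap.star_eq_adjoint, ContinuousLinearMap.adjoint_inner_right,
    ← inner_conj_symm, L2.inner_single, map_one, one_mul, weightedShift_apply,
    lp.coeFn_smul, Pi.smul_apply, basisVec_apply, basisVec_apply]
  by_cases h : y = φ x
  · simp [h]
  · simp [h, Ne.symm h]

theorem commutator_basisVec {A C : L2 (ℕ × ℤ) →L[ℂ] L2 (ℕ × ℤ)} {d : ℕ × ℤ → ℝ}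
    (h : IsCommutator (diagOp d) A C) {x y : ℕ × ℤ} {c : ℂ} (hA : A (basisVec x) = c • basisVec y) :
    C (basisVec x) = (((d y - d x : ℝ) : ℂ) * c) • basisVec y := by
  ext z
  have e := h.coord ⟨basisVec x, single_mem x 1⟩ z
  rw [diagOp_single, map_smul] at e
  simp only [hA, lp.coeFn_smul, Pi.smul_apply, smul_eq_mul, basisVec_apply] at e ⊢
  by_cases hz : z = y
  · subst hz
    simp only [if_true, mul_one] at e ⊢
    push_cast
    linear_combination -e
  · simp only [hz, if_false, mul_zero, add_zero] at e ⊢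
    exact e.symm

variable {A C : L2 (ℕ × ℤ) →L[ℂ] L2 (ℕ × ℤ)} {n : ℕ}

theorem hasSymbol_smul_T {c : ℕ × ℤ → ℂ} {k : ℤ} {b : ℂ}
    (hA : ∀ᶠ x in fstTop, A (basisVec x) = c x • basisVec (shiftLeft k x))
    (hc : Tendsto (fun x => c x - sgn x ^ n * b) fstTop (𝓝 0)) : HasSymbol n A (b • T k) := by
  rw [tendsto_zero_iff_norm_tendsto_zero] at hc
  refine tendsto_zero_iff_norm_tendsto_zero.2 (hc.congr' ?_)
  filter_upwards [hA] with x hx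
  rw [hx, map_smul, shiftSum_T, smul_smul, ← sub_smul, norm_smul, norm_basisVec, mul_one]

theorem hasSymbol_zero {c : ℕ × ℤ → ℂ} {y : ℕ × ℤ → ℕ × ℤ}
    (hA : ∀ x, A (basisVec x) = c x • basisVec (y x)) (hc : Tendsto c fstTop (𝓝 0)) :
    HasSymbol n A 0 := by
  rw [tendsto_zero_iff_norm_tendsto_zero] at hc
  refine tendsto_zero_iff_norm_tendsto_zero.2 (hc.congr fun x => ?_)
  rw [hA, map_zero, smul_zero, sub_zero, norm_smul, norm_basisVec, mul_one]

/-- `A` has a symbol `p`, and `[D, A]` has the symbol `-z dp/dz`. -/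
def HasDiffSymbol (A : L2 (ℕ × ℤ) →L[ℂ] L2 (ℕ × ℤ)) (p : LaurentPolynomial ℂ) : Prop :=
  ∃ C, IsCommutator (diagOp eig) A C ∧ HasSymbol 0 A p ∧ HasSymbol 1 C (negEuler p)

theorem tendsto_sqrt_one_sub {q : ℝ} (hq : |q| < 1) (l : ℕ) :
    Tendsto (fun x : ℕ × ℤ => ((√(1 - q ^ (2 * (x.1 + l))) : ℝ) : ℂ)) fstTop (𝓝 1) := by
  have h₁ : Tendsto (fun i : ℕ => q ^ (2 * (i + l))) atTop (𝓝 0) := by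
    have h₂ : |q ^ 2| < 1 := by
      rw [abs_pow]
      exact pow_lt_one₀ (abs_nonneg q) hq two_ne_zero
    simp only [pow_mul]
    exact (tendsto_pow_atTop_nhds_zero_of_abs_lt_one h₂).comp (tendsto_add_atTop_nat l)
  have h₃ := (h₁.const_sub 1).sqrt
  rw [sub_zero, Real.sqrt_one] at h₃
  have h₄ := (Complex.continuous_ofReal.tendsto 1).comp (h₃.comp tendsto_fst)
  rw [Complex.ofReal_one] at h₄
  exact h₄

/-- For `i ≥ k` the eigenvalue of `D` changes by exactly `-k sgn(j)` under the shift. The commutator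
is thus again a weighted shift by `k`, with limiting weight `-k sgn(j)`. -/
theorem hasDiffSymbol_of_shift {c : ℕ × ℤ → ℂ} {k : ℤ}
    (hC : IsCommutator (diagOp eig) A C)
    (hA : ∀ᶠ x in fstTop, A (basisVec x) = c x • basisVec (shiftLeft k x))
    (hc : Tendsto c fstTop (𝓝 1)) : HasDiffSymbol A (T k) := by
  have hc' : Tendsto (fun x => c x - 1) fstTop (𝓝 0) := by simpa using hc.sub_const 1
  refine ⟨C, hC, ?_, ?_⟩
  · rw [← one_smul ℂ (T k)]
    exact hasSymbol_smul_T hA (by simpa using hc')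
  · rw [negEuler_T]
    refine hasSymbol_smul_T (c := fun x => sgn x * -(k : ℂ) * c x) ?_ ?_
    · filter_upwards [hA, eventually_fst_ge k] with x hx hk
      rw [commutator_basisVec hC hx]
      congr 2
      have h₁ : ((((x.1 : ℤ) - k).toNat : ℝ)) = x.1 - k := by
        exact_mod_cast congrArg (Int.cast (R := ℝ)) (Int.toNat_of_nonneg (sub_nonneg.2 hk))
      have h₂ : eig (shiftLeft k x) =
          (((x.1 : ℤ) - k).toNat : ℝ) * (if 0 ≤ x.2 then 1 else -1) + x.2 := rfl
      rw [h₂, h₁, eig, sgn]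
      by_cases h : 0 ≤ x.2
      · simp only [if_pos h]
        push_cast
        ring
      · simp only [if_neg h]
        push_cast
        ring
    · rw [tendsto_zero_iff_norm_tendsto_zero] at hc' ⊢
      have := hc'.const_mul ‖(k : ℂ)‖
      rw [mul_zero] at this
      refine this.congr fun x => ?_
      have h₁ : sgn x * -(k : ℂ) * c x - sgn x ^ 1 * -(k : ℂ) =
          sgn x ^ 1 * (-(k : ℂ) * (c x - 1)) := by ring
      rw [h₁, norm_mul, norm_sgn_pow, one_mul, norm_mul, norm_neg]

/-- Moving `j` across `0` flips the sign in `D` and can change the eigenvalue by `2i + 1`. The decay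
`|q|^i` of the weights beats this linear growth, so the commutator also vanishes asymptotically. -/
theorem hasDiffSymbol_zero {c : ℕ × ℤ → ℂ} {y : ℕ × ℤ → ℕ × ℤ}
    (hC : IsCommutator (diagOp eig) A C) (hA : ∀ x, A (basisVec x) = c x • basisVec (y x))
    {q : ℝ} (hq : |q| < 1) (hc : ∀ x, ‖c x‖ ≤ |q| ^ x.1)
    (hd : ∀ x, |eig (y x) - eig x| ≤ 2 * x.1 + 1) : HasDiffSymbol A 0 := by
  have hq' : |(|q|)| < 1 := by rwa [abs_abs]
  have h₁ := (tendsto_pow_atTop_nhds_zero_of_abs_lt_one hq').comp tendsto_fst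
  have h₂ := (tendsto_self_mul_const_pow_of_abs_lt_one hq').comp tendsto_fst
  refine ⟨C, hC, hasSymbol_zero hA (squeeze_zero_norm hc h₁), ?_⟩
  rw [map_zero]
  refine hasSymbol_zero (fun x => commutator_basisVec hC (hA x))
    (squeeze_zero_norm (a := fun x : ℕ × ℤ => 2 * ((x.1 : ℝ) * |q| ^ x.1) + |q| ^ x.1)
      (fun x => ?_) (by simpa using (h₂.const_mul 2).add h₁))
  rw [norm_mul, Complex.norm_real, Real.norm_eq_abs]
  calc _ ≤ (2 * (x.1 : ℝ) + 1) * |q| ^ x.1 :=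
        mul_le_mul (hd x) (hc x) (norm_nonneg _) (by positivity)
    _ = _ := by ring

/-! ### Symbols of `α`, `β`, their adjoints and all of `𝒜_f`. -/

variable {q : ℝ} (hq : |q| < 1)

theorem hasDiffSymbol_α (hq : |q| < 1) : HasDiffSymbol (opα q) (T 1) := by
  obtain ⟨C, hC⟩ := commutator_α q
  refine hasDiffSymbol_of_shift hC ?_ (tendsto_sqrt_one_sub hq 0)
  -- The index `i = 0`, where the shift is truncated, is left out.
  filter_upwards [eventually_fst_ge 1] with x hx
  obtain ⟨i, j⟩ := x
  obtain _ | i := i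
  · simp at hx
  · refine (weightedShift_basisVec (φ := fun x : ℕ × ℤ => (x.1 + 1, x.2)) _ _ (i, j)).trans ?_
    simp [shiftLeft]

theorem hasDiffSymbol_star_α (hq : |q| < 1) : HasDiffSymbol (star (opα q)) (T (-1)) := by
  obtain ⟨C, hC⟩ := commutator_α q
  refine hasDiffSymbol_of_shift hC.star (Eventually.of_forall fun x => ?_)
    (tendsto_sqrt_one_sub hq 1)
  refine (star_weightedShift_basisVec _ _ x).trans ?_
  rw [Complex.conj_ofReal]
  congr 2

theorem hasDiffSymbol_β (hq : |q| < 1) : HasDiffSymbol (opβ q hq) 0 := by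
  obtain ⟨C, hC⟩ := commutator_β q hq
  refine hasDiffSymbol_zero (c := fun x => ((q ^ x.1 : ℝ) : ℂ)) (y := fun x => (x.1, x.2 - 1)) hC
    (fun x => ?_) hq (fun x => ?_) fun x => ?_
  · obtain ⟨i, j⟩ := x
    obtain ⟨j, rfl⟩ : ∃ l, j = l + 1 := ⟨j - 1, by ring⟩
    simp only [add_sub_cancel_right]
    exact weightedShift_basisVec (φ := fun x : ℕ × ℤ => (x.1, x.2 + 1)) _ _ (i, j)
  · rw [Complex.norm_real, norm_pow, Real.norm_eq_abs]
  · have : (0 : ℝ) ≤ x.1 := Nat.cast_nonneg _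
    rw [eig, eig, abs_le]
    push_cast
    split_ifs <;> first | omega | (constructor <;> linarith)

theorem hasDiffSymbol_star_β (hq : |q| < 1) : HasDiffSymbol (star (opβ q hq)) 0 := by
  obtain ⟨C, hC⟩ := commutator_β q hq
  refine hasDiffSymbol_zero (c := fun x => ((q ^ x.1 : ℝ) : ℂ)) (y := fun x => (x.1, x.2 + 1))
    hC.star (fun x => ?_) hq (fun x => ?_) fun x => ?_
  · refine (star_weightedShift_basisVec _ _ x).trans ?_
    rw [Complex.conj_ofReal]
  · rw [Complex.norm_real, norm_pow, Real.norm_eq_abs]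
  · have : (0 : ℝ) ≤ x.1 := Nat.cast_nonneg _
    rw [eig, eig, abs_le]
    push_cast
    split_ifs <;> first | omega | (constructor <;> linarith)

theorem exists_hasDiffSymbol (a : Af q hq) :
    ∃ p, HasDiffSymbol (a : L2 (ℕ × ℤ) →L[ℂ] L2 (ℕ × ℤ)) p := by
  obtain ⟨A, hA⟩ := a
  -- Viewing the `*`-algebra as the algebra generated by the generators and their adjoints avoids
  -- having to know that symbols are compatible with taking adjoints.
  change A ∈ Algebra.adjoin ℂ ({opα q, opβ q hq} ∪ star {opα q, opβ q hq}) at hA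
  change ∃ p, HasDiffSymbol A p
  induction hA using Algebra.adjoin_induction with
  | mem A hA =>
    rcases hA with (rfl | rfl) | hA
    · exact ⟨_, hasDiffSymbol_α hq⟩
    · exact ⟨_, hasDiffSymbol_β hq⟩
    · rw [Set.mem_star] at hA
      rcases hA with hA | hA
      · rw [← star_star A, hA]
        exact ⟨_, hasDiffSymbol_star_α hq⟩
      · rw [← star_star A, Set.mem_singleton_iff.1 hA]
        exact ⟨_, hasDiffSymbol_star_β hq⟩
  | algebraMap c =>
    refine ⟨c • T 0, 0, isCommutator_algebraMap c, ?_, ?_⟩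
    · rw [Algebra.algebraMap_eq_smul_one, T_zero]
      exact HasSymbol.one.smul c
    · rw [map_smul, negEuler_T, Int.cast_zero, neg_zero, zero_smul, smul_zero]
      exact HasSymbol.zero 1
  | add A B _ _ hA hB =>
    obtain ⟨p, C, h₁, h₂, h₃⟩ := hA
    obtain ⟨r, C', h₁', h₂', h₃'⟩ := hB
    exact ⟨p + r, _, h₁.add h₁', h₂.add h₂', by rw [map_add]; exact h₃.add h₃'⟩
  | mul A B _ _ hA hB =>
    obtain ⟨p, C, h₁, h₂, h₃⟩ := hA
    obtain ⟨r, C', h₁', h₂', h₃'⟩ := hB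
    -- The Leibniz rules for `[D, ·]` and for `-z d/dz` match term by term; each term contains
    -- exactly one commutator, hence one factor `sgn(j)`.
    exact ⟨p * r, _, h₁.mul h₁', h₂.mul h₂' rfl, by
      rw [negEuler_mul]; exact (h₂.mul h₃' rfl).add (h₃.mul h₂' rfl)⟩

/-! ### The symbol map on universal forms -/

/-- The symbol homomorphism `σ : 𝒜_f → ℂ[z, z⁻¹]`. -/
noncomputable def symbol : Af q hq →ₐ[ℂ] LaurentPolynomial ℂ :=
  -- Symbols are selected by choice; their uniqueness turns the closure rules for sums, multiples
  -- and products into the laws of a homomorphism.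
  have hs : ∀ a : Af q hq, HasSymbol 0 (a : L2 (ℕ × ℤ) →L[ℂ] L2 (ℕ × ℤ))
      (exists_hasDiffSymbol hq a).choose := fun a =>
    (exists_hasDiffSymbol hq a).choose_spec.choose_spec.2.1
  AlgHom.ofLinearMap
    { toFun := fun a => (exists_hasDiffSymbol hq a).choose
      map_add' := fun a b => (hs (a + b)).unique ((hs a).add (hs b))
      map_smul' := fun c a => (hs (c • a)).unique ((hs a).smul c) }
    ((hs 1).unique HasSymbol.one)
    (fun a b => (hs (a * b)).unique ((hs a).mul (hs b) rfl))

theorem hasDiffSymbol_symbol (a : Af q hq) :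
    HasDiffSymbol (a : L2 (ℕ × ℤ) →L[ℂ] L2 (ℕ × ℤ)) (symbol hq a) :=
  (exists_hasDiffSymbol hq a).choose_spec

theorem hasSymbol_symbol (a : Af q hq) :
    HasSymbol 0 (a : L2 (ℕ × ℤ) →L[ℂ] L2 (ℕ × ℤ)) (symbol hq a) :=
  (hasDiffSymbol_symbol hq a).choose_spec.2.1

theorem symbol_eq {a : Af q hq} {p : LaurentPolynomial ℂ}
    (h : HasDiffSymbol (a : L2 (ℕ × ℤ) →L[ℂ] L2 (ℕ × ℤ)) p) : symbol hq a = p :=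
  (hasSymbol_symbol hq a).unique h.choose_spec.2.1

theorem hasSymbol_comm (a : Af q hq) :
    HasSymbol 1 ((triple q hq).comm a) (negEuler (symbol hq a)) := by
  obtain ⟨C, h₁, -, h₃⟩ := hasDiffSymbol_symbol hq a
  rwa [((triple q hq).comm_spec a).unique h₁]

@[simp]
theorem symbol_α : symbol hq (α q hq) = T 1 := symbol_eq hq (hasDiffSymbol_α hq)

@[simp]
theorem symbol_star_α : symbol hq (star (α q hq)) = T (-1) :=
  symbol_eq hq (hasDiffSymbol_star_α hq)

@[simp]
theorem symbol_β : symbol hq (β q hq) = 0 := symbol_eq hq (hasDiffSymbol_β hq)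

@[simp]
theorem symbol_star_β : symbol hq (star (β q hq)) = 0 := symbol_eq hq (hasDiffSymbol_star_β hq)

@[simp]
theorem symbol_αpow (i : ℤ) : symbol hq (αpow q hq i) = T i := by
  rw [αpow]
  split_ifs with hi
  · rw [map_pow, symbol_α, T_pow, mul_one, Int.toNat_of_nonneg hi]
  · rw [map_pow, symbol_star_α, T_pow, Int.toNat_of_nonneg (by omega)]
    congr 1
    ring

theorem symbol_monomial (i : ℤ) (j k : ℕ) :
    symbol hq (monomial q hq i j k) = if j = 0 ∧ k = 0 then T i else 0 := by
  rw [monomial, map_mul, map_mul, map_pow, map_pow, symbol_αpow, symbol_β, symbol_star_β]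
  rcases eq_or_ne j 0 with rfl | hj <;> rcases eq_or_ne k 0 with rfl | hk <;> simp [*]

/-- The symbol of a universal form: `a ↦ σ a`, `δ a ↦ -z d(σ a)/dz`. -/
noncomputable def formSymbol : UDGA.Omega (Af q hq) →ₐ[ℂ] LaurentPolynomial ℂ :=
  UDGA.lift (symbol hq) (negEuler ∘ₗ (symbol hq).toLinearMap) (by
    intro a b
    simp [negEuler_mul])

@[simp]
theorem formSymbol_incl (a : Af q hq) : formSymbol hq (UDGA.incl _ a) = symbol hq a :=
  UDGA.lift_incl _ _ _ _ a

@[simp]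
theorem formSymbol_delta0 (a : Af q hq) :
    formSymbol hq (UDGA.delta0 _ a) = negEuler (symbol hq a) :=
  UDGA.lift_delta0 _ _ _ _ a

/-- Each factor `δ a` brings one factor `sgn(j)`. The symbol itself does not record these signs;
they are kept by the degree `n`, so the comparison is made degree by degree. -/
theorem hasSymbol_rep_pow (n : ℕ) (ω : UDGA.Omega (Af q hq))
    (h : ω ∈ LinearMap.range (UDGA.delta0 (Af q hq)) ^ n) :
    HasSymbol n ((triple q hq).rep ω) (formSymbol hq ω) := by
  induction n generalizing ω with
  | zero =>
    rw [pow_zero, Submodule.mem_one] at h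
    obtain ⟨c, rfl⟩ := h
    rw [AlgHom.commutes, AlgHom.commutes, Algebra.algebraMap_eq_smul_one,
      Algebra.algebraMap_eq_smul_one]
    exact HasSymbol.one.smul c
  | succ n ih =>
    rw [pow_succ] at h
    refine Submodule.mul_induction_on h ?_ ?_
    · rintro η hη _ ⟨a, rfl⟩
      rw [map_mul, map_mul, formSymbol_delta0]
      have : (triple q hq).rep (UDGA.delta0 _ a) = (triple q hq).comm a :=
        UDGA.lift_delta0 _ _ _ _ a
      rw [this]
      exact (ih η hη).mul (hasSymbol_comm hq a) rfl
    · intro x y hx hy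
      rw [map_add, map_add]
      exact hx.add hy

theorem hasSymbol_rep (n : ℕ) (ω : UDGA.Omega (Af q hq)) (h : ω ∈ UDGA.forms (Af q hq) n) :
    HasSymbol n ((triple q hq).rep ω) (formSymbol hq ω) := by
  refine Submodule.mul_induction_on h ?_ ?_
  · rintro _ ⟨a, rfl⟩ η hη
    rw [AlgHom.toLinearMap_apply, map_mul, map_mul, formSymbol_incl]
    have : (triple q hq).rep (UDGA.incl _ a) = a := UDGA.lift_incl _ _ _ _ a
    rw [this]
    exact (hasSymbol_symbol hq a).mul (hasSymbol_rep_pow hq n η hη) (zero_add n)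
  · intro x y hx hy
    rw [map_add, map_add]
    exact hx.add hy

theorem tendsto_meanSq {p : LaurentPolynomial ℂ} (hA : HasSymbol n A p) :
    Tendsto ((triple q hq).meanSq A) (𝓝[>] 0) (𝓝 (∑ k ∈ p.coeff.support, ‖p.coeff k‖ ^ 2)) :=
  tendsto_heat_average (C := ‖A‖ ^ 2) (fun x => by
    rw [abs_of_nonneg (by positivity)]
    exact DiagonalSpectralTriple.norm_single_le A x) hA.tendsto_norm_sq

variable (L : GeneralizedLimit)

/-- The seminorm of a form is the `ℓ²`-norm of the coefficients of its symbol. -/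
theorem pairing_self_eq (n : ℕ) (ω : UDGA.Omega (Af q hq)) (h : ω ∈ UDGA.forms (Af q hq) n) :
    (triple q hq).pairing L ω ω = ((∑ k ∈ (formSymbol hq ω).coeff.support,
      ‖(formSymbol hq ω).coeff k‖ ^ 2 : ℝ) : ℂ) := by
  rw [DiagonalSpectralTriple.pairing_self]
  exact L.lim_eq _ _
    ((Complex.continuous_ofReal.tendsto _).comp (tendsto_meanSq hq (hasSymbol_rep hq n ω h)))

/-- The right-hand side does not involve `L`: this removes the generalized limit from the problem.
-/
theorem mem_null_iff (n : ℕ) (ω : UDGA.Omega (Af q hq)) :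
    ω ∈ (triple q hq).null L n ↔ ω ∈ UDGA.forms (Af q hq) n ∧ formSymbol hq ω = 0 := by
  refine and_congr_right fun h => ?_
  rw [pairing_self_eq hq L n ω h, Complex.ofReal_eq_zero, sum_norm_sq_coeff_eq_zero]

/-! ### The square-integrable forms -/

theorem delta0_pow_mem (a : Af q hq) (n : ℕ) :
    UDGA.delta0 _ a ^ n ∈ LinearMap.range (UDGA.delta0 (Af q hq)) ^ n :=
  Submodule.pow_mem_pow _ (LinearMap.mem_range_self _ a) n

theorem formSymbol_delta0_α : formSymbol hq (UDGA.delta0 _ (α q hq)) = -T 1 := by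
  simp

theorem exists_formSymbol_eq (n : ℕ) (p : LaurentPolynomial ℂ) :
    ∃ ω ∈ UDGA.forms (Af q hq) n, formSymbol hq ω = p := by
  induction p using LaurentPolynomial.induction_linear with
  | add p r hp hr =>
    obtain ⟨ω, h, rfl⟩ := hp
    obtain ⟨η, h', rfl⟩ := hr
    exact ⟨ω + η, add_mem h h', map_add _ _ _⟩
  | smul c k =>
    -- Since `δ α` has symbol `-z`, the form `α_{k-n} (δ α)ⁿ` has symbol `(-1)ⁿ z^k`.
    refine ⟨(c * (-1) ^ n) • (UDGA.incl _ (αpow q hq (k - n)) * UDGA.delta0 _ (α q hq) ^ n),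
      Submodule.smul_mem _ _ (Submodule.mul_mem_mul ⟨_, rfl⟩ (delta0_pow_mem hq _ n)), ?_⟩
    rw [map_smul, map_mul, map_pow, formSymbol_delta0_α, formSymbol_incl, symbol_αpow,
      ← neg_one_smul ℂ (T 1), smul_pow, T_pow, mul_smul_comm, ← T_add, smul_smul, mul_assoc,
      ← mul_pow]
    simp

/-- The symbols of `δ α` and `δ α*` are `-z` and `z⁻¹`, so `α_l δα + α_{l+2} δα*` has symbol
`-z^{l+1} + z^{l+1} = 0`. Its differential `δα_l δα + δα_{l+2} δα*` has symbol `(l - (l + 2))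
z^{l+1} = -2 z^{l+1}`, which is not zero. Multiplying on the right by `(δ α)^m` gives null forms of
every positive degree. -/
theorem exists_null_delta_eq (m : ℕ) (p : LaurentPolynomial ℂ) :
    ∃ η ∈ (triple q hq).null L (m + 1), formSymbol hq (UDGA.delta _ η) = p := by
  induction p using LaurentPolynomial.induction_linear with
  | add p r hp hr =>
    obtain ⟨ω, h, rfl⟩ := hp
    obtain ⟨η, h', rfl⟩ := hr
    exact ⟨ω + η, add_mem h h', by rw [map_add, map_add]⟩
  | smul c k =>
    set ξ := UDGA.delta0 _ (α q hq) ^ m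
    have hξ : ∀ a : Af q hq,
        UDGA.delta0 _ a * ξ ∈ LinearMap.range (UDGA.delta0 (Af q hq)) ^ (m + 1) := by
      intro a
      rw [pow_succ']
      exact Submodule.mul_mem_mul (LinearMap.mem_range_self _ a) (delta0_pow_mem hq _ m)
    have hξs : formSymbol hq ξ = (-1 : ℂ) ^ m • T m := by
      rw [map_pow, formSymbol_delta0_α, ← neg_one_smul ℂ (T 1), smul_pow, T_pow, mul_one]
    -- The factor `(δ α)^m` contributes `(-1)^m z^m`, so the differential has symbol `-2 (-1)^m
    -- z^{l+1+m}`. This choice of `l` makes the exponent `k`, and the scalar `-(c (-1)^m / 2)` below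
    -- normalizes the coefficient to `c`.
    set l : ℤ := k - 1 - m
    refine ⟨(-(c * (-1) ^ m / 2)) • (UDGA.incl _ (αpow q hq l) * (UDGA.delta0 _ (α q hq) * ξ) +
      UDGA.incl _ (αpow q hq (l + 2)) * (UDGA.delta0 _ (star (α q hq)) * ξ)), ?_, ?_⟩
    · refine (mem_null_iff hq L _ _).2 ⟨Submodule.smul_mem _ _ (add_mem
        (Submodule.mul_mem_mul ⟨_, rfl⟩ (hξ _)) (Submodule.mul_mem_mul ⟨_, rfl⟩ (hξ _))), ?_⟩
      have h₁ : (T (l + 2) : LaurentPolynomial ℂ) * T (-1) = T l * T 1 := by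
        rw [← T_add, ← T_add]
        congr 1
        ring
      simp only [map_smul, map_add, map_mul, formSymbol_incl, formSymbol_delta0, symbol_αpow,
        symbol_α, symbol_star_α, negEuler_T, ← mul_assoc, mul_smul_comm, smul_mul_assoc, h₁]
      simp only [Int.cast_one, Int.cast_neg, neg_neg, neg_smul, one_smul, neg_add_cancel, smul_zero]
    · rw [map_smul, map_add, UDGA.delta_incl_mul _ _ _ _ (hξ _),
        UDGA.delta_incl_mul _ _ _ _ (hξ _)]
      have h₁ : (T (l + 2) : LaurentPolynomial ℂ) * (T (-1) * T m) = T k := by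
        rw [← T_add, ← T_add]
        congr 1
        ring
      have h₂ : (T l : LaurentPolynomial ℂ) * (T 1 * T m) = T k := by
        rw [← T_add, ← T_add]
        congr 1
        ring
      simp only [map_smul, map_add, map_mul, formSymbol_delta0, symbol_αpow, hξs,
        symbol_α, symbol_star_α, negEuler_T, mul_smul_comm, smul_mul_assoc, h₁, h₂, smul_smul,
        ← add_smul]
      congr 1
      have h₃ : ((-1 : ℂ) ^ m) * (-1) ^ m = 1 := by rw [← mul_pow]; simp
      push_cast
      linear_combination c * h₃

/-- Subtracting from `ω` the differential of a null form with the same symbol leaves a form of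
symbol `0`, that is, a null form. -/
theorem subsingleton_sqForms (n : ℕ) (hn : 2 ≤ n) : Subsingleton ((triple q hq).SqForms L n) := by
  obtain ⟨m, rfl⟩ := Nat.exists_eq_add_of_le' hn
  rw [Submodule.Quotient.subsingleton_iff, Submodule.submoduleOf,
    Submodule.comap_subtype_eq_top]
  intro ω hω
  obtain ⟨η, hη, h⟩ := exists_null_delta_eq hq L m (formSymbol hq ω)
  rw [← sub_add_cancel ω (UDGA.delta _ η)]
  refine Submodule.add_mem_sup ((mem_null_iff hq L _ _).2 ⟨sub_mem hω
    (UDGA.delta_mem _ _ _ hη.1), ?_⟩) (Submodule.mem_map_of_mem hη)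
  rw [map_sub, h, sub_self]

/-- In degree `1` the differentials of null `0`-forms add nothing: if `σ(a) = 0`, then `δ a` has
symbol `-z d/dz σ(a) = 0` and is already null. -/
theorem mem_relations_iff (n : ℕ) (hn : n < 2) (ω : UDGA.forms (Af q hq) n) :
    (ω : UDGA.Omega (Af q hq)) ∈ (triple q hq).relations L n ↔
      formSymbol hq (ω : UDGA.Omega (Af q hq)) = 0 := by
  obtain ⟨ω, hω⟩ := ω
  interval_cases n
  · exact (mem_null_iff hq L 0 ω).trans (and_iff_right hω)
  · have h : ((triple q hq).null L 0).map (UDGA.delta _) ≤ (triple q hq).null L 1 := by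
      rintro _ ⟨η, hη, rfl⟩
      obtain ⟨h₁, h₂⟩ := (mem_null_iff hq L 0 η).1 hη
      refine (mem_null_iff hq L 1 _).2 ⟨UDGA.delta_mem _ _ _ h₁, ?_⟩
      rw [UDGA.forms, pow_zero, mul_one] at h₁
      obtain ⟨a, rfl⟩ := h₁
      rw [AlgHom.toLinearMap_apply, formSymbol_incl] at h₂
      rw [AlgHom.toLinearMap_apply, UDGA.delta_incl, formSymbol_delta0, h₂, map_zero]
    have h' : (triple q hq).relations L 1 = (triple q hq).null L 1 := sup_eq_left.2 h
    rw [h']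
    exact (mem_null_iff hq L 1 ω).trans (and_iff_right hω)

/-- The isomorphism `Ω̃ⁿ_D(𝒜_f) ≃ ℂ[z, z⁻¹]` for `n < 2`, induced by the symbol map. -/
noncomputable def sqFormsEquiv (n : ℕ) (hn : n < 2) :
    (triple q hq).SqForms L n ≃ₗ[ℂ] LaurentPolynomial ℂ :=
  (Submodule.quotEquivOfEq _
    (LinearMap.ker ((formSymbol hq).toLinearMap.domRestrict (UDGA.forms (Af q hq) n))) (by
      ext ω
      exact mem_relations_iff hq L n hn ω)).trans
    (LinearMap.quotKerEquivOfSurjective _ fun p => by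
      obtain ⟨ω, h, e⟩ := exists_formSymbol_eq hq n p
      exact ⟨⟨ω, h⟩, e⟩)

theorem sqFormsEquiv_cls (n : ℕ) (hn : n < 2) (ω : UDGA.forms (Af q hq) n) :
    sqFormsEquiv hq L n hn ((triple q hq).cls L n ω) =
      formSymbol hq (ω : UDGA.Omega (Af q hq)) := rfl

theorem sqFormsEquiv_biAct (n : ℕ) (hn : n < 2) (a b : Af q hq) (ω : UDGA.forms (Af q hq) n) :
    sqFormsEquiv hq L n hn ((triple q hq).cls L n (UDGA.biAct a ω b)) =
      symbol hq a * sqFormsEquiv hq L n hn ((triple q hq).cls L n ω) * symbol hq b := by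
  rw [sqFormsEquiv_cls, sqFormsEquiv_cls, UDGA.biAct, map_mul, map_mul, formSymbol_incl,
    formSymbol_incl]

theorem sqFormsEquiv_diff (a : Af q hq) :
    sqFormsEquiv hq L 1 one_lt_two ((triple q hq).diff L 0 ((triple q hq).cls₀ L a)) =
      negEuler (symbol hq a) := by
  change formSymbol hq (UDGA.delta _ (UDGA.incl _ a)) = _
  rw [UDGA.delta_incl, formSymbol_delta0]

end SUq2

theorem mainTheorem2 (q : ℝ) (hq0 : q ≠ 0) (hq : |q| < 1) (L : GeneralizedLimit) :
    (∀ n : ℕ, 2 ≤ n → Subsingleton ((SUq2.triple q hq).SqForms L n)) ∧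
    ∃ σ : SUq2.Af q hq →ₐ[ℂ] LaurentPolynomial ℂ,
      σ (SUq2.α q hq) = LaurentPolynomial.T 1 ∧
      σ (star (SUq2.α q hq)) = LaurentPolynomial.T (-1) ∧
      σ (SUq2.β q hq) = 0 ∧
      σ (star (SUq2.β q hq)) = 0 ∧
      ∃ (Φ₀ : (SUq2.triple q hq).SqForms L 0 ≃ₗ[ℂ] LaurentPolynomial ℂ)
        (Φ₁ : (SUq2.triple q hq).SqForms L 1 ≃ₗ[ℂ] LaurentPolynomial ℂ),
        (∀ (a b : SUq2.Af q hq) (ω : UDGA.forms (SUq2.Af q hq) 0),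
          Φ₀ ((SUq2.triple q hq).cls L 0 (UDGA.biAct a ω b)) =
            σ a * Φ₀ ((SUq2.triple q hq).cls L 0 ω) * σ b) ∧
        (∀ (a b : SUq2.Af q hq) (ω : UDGA.forms (SUq2.Af q hq) 1),
          Φ₁ ((SUq2.triple q hq).cls L 1 (UDGA.biAct a ω b)) =
            σ a * Φ₁ ((SUq2.triple q hq).cls L 1 ω) * σ b) ∧
        (∀ a : SUq2.Af q hq, Φ₀ ((SUq2.triple q hq).cls₀ L a) = σ a) ∧
        (∀ (i : ℤ) (j k : ℕ),
          Φ₁ ((SUq2.triple q hq).diff L 0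
              ((SUq2.triple q hq).cls₀ L (SUq2.monomial q hq i j k))) =
            if j = 0 ∧ k = 0 then (-(i : ℂ)) • LaurentPolynomial.T i else 0) := by
  refine ⟨fun n hn => SUq2.subsingleton_sqForms hq L n hn, SUq2.symbol hq, SUq2.symbol_α hq,
    SUq2.symbol_star_α hq, SUq2.symbol_β hq, SUq2.symbol_star_β hq,
    SUq2.sqFormsEquiv hq L 0 two_pos, SUq2.sqFormsEquiv hq L 1 one_lt_two,
    SUq2.sqFormsEquiv_biAct hq L 0 two_pos, SUq2.sqFormsEquiv_biAct hq L 1 one_lt_two,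
    fun a => ?_, fun i j k => ?_⟩
  · exact SUq2.formSymbol_incl hq a
  · rw [SUq2.sqFormsEquiv_diff, SUq2.symbol_monomial]
    split_ifs
    · exact LaurentPolynomial.negEuler_T i
    · exact map_zero _
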